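/- Let $f\in C_0^\infty(\mathbb R)$ be a real function (smooth with compact support). Let $H^1_{per}=H^1_{per}(-\pi,\pi)$ be the Sobolev space of real $2\pi$-periodic functions with norm $\|u\|_{H^1}^2=\|u\|_{L^2(-\pi,\pi)}^2+\|u'\|_{L^2(-\pi,\pi)}^2$, and let $B(R)=\{u\in H^1_{per}:\|u\|_{H^1}<R\}$. For $K\in\mathbb N$ let $$(P_Ku)(x)=\frac{a_0}{2}+\sum_{n=1}^K \big(a_n\cos(nx)+b_n\sin(nx)\big),\quad a_n=\frac1\pi\int_{-\pi}^{\pi}u(x)\cos(nx)\,dx,\quad b_n=\frac1\pi\int_{-\pi}^{\pi}u(x)\sin(nx)\,dx,$$ be the orthogonal projection onto the first $2K+1$ Fourier modes, and let $\langle g\rangle=\frac1{2\pi}\int_{-\pi}^{\pi}g(x)\,dx$. For $u\in H^1_{per}$ let $a=a(u)$ be the (unique, smooth, positive and $2\pi$-periodic) solution of $$a'=\tfrac12\big[f(P_Ku)-\langle f(P_Ku)\rangle\big]a,\qquad a(-\pi)=1,$$ and define $W=W_K:H^1_{per}\to H^1_{per}$ by $W(u)(x)=a(u)(x)^{-1}u(x)$.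 Then there is a constant $C>1$, depending only on $f$ (in particular independent of $K$ and $R$), such that for every $R>0$ there exist $K_0=K_0(R)$ and constants $M_n=M_n(R)$, $n=0,1,2,\dots$, independent of $K$, such that for every $K>K_0$ the following hold. 1. $W$ is a $C^\infty$ diffeomorphism from $B(R)$ onto its image $W(B(R))$: this image is open in $H^1_{per}$, $W$ is injective and $C^\infty$ on $B(R)$, and the inverse $U=W^{-1}:W(B(R))\to B(R)$ is $C^\infty$. 2. $W$, $U$ and their Fréchet derivatives are bounded uniformly in $K$: for every $n\ge 0$, $\|D^nW(u)\|\le M_n$ for all $u\in B(R)$ and $\|D^nU(w)\|\le M_n$ for all $w\in W(B(R))$. 3. $B(C^{-1}R)\subset W(B(R))\subset B(CR)$. -/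

import Mathlib

open Real Set MeasureTheory
open scoped ContDiff

noncomputable section

namespace PeriodicRDA

/-- Lebesgue measure on the interval `(-π, π]`. -/
abbrev perMeasure : Measure ℝ := volume.restrict (Ioc (-π) π)

/-- The real Hilbert space `L²(-π, π)`. -/
abbrev L2 : Type := Lp ℝ 2 perMeasure

/-- `v` is the weak derivative of `u` in the periodic sense: integration by parts holds against
every smooth `2π`-periodic test function. -/
def IsWeakDeriv (u v : ℝ → ℝ) : Prop :=
  ∀ φ : ℝ → ℝ, ContDiff ℝ ∞ φ → Function.Periodic φ (2 * π) →
    ∫ x, u x * deriv φ x ∂perMeasure = -∫ x, v x * φ x ∂perMeasure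

theorem memLp_mul_continuous {g u : ℝ → ℝ} (hg : Continuous g) (hu : MemLp u 2 perMeasure) :
    MemLp (fun x => g x * u x) 2 perMeasure := by
  obtain ⟨c, hc⟩ := isCompact_Icc.exists_bound_of_continuousOn (s := Icc (-π) π) hg.continuousOn
  refine hu.of_le_mul (c := c) (hg.aestronglyMeasurable.mul hu.1) ?_
  refine (ae_restrict_iff' measurableSet_Ioc).2 (Filter.Eventually.of_forall fun x hx => ?_)
  rw [norm_mul]
  exact mul_le_mul_of_nonneg_right (hc x (Ioc_subset_Icc_self hx)) (norm_nonneg _)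

theorem integrable_mul_continuous {u g : ℝ → ℝ} (hg : Continuous g) (hu : MemLp u 2 perMeasure) :
    Integrable (fun x => u x * g x) perMeasure := by
  have h := (memLp_mul_continuous hg hu).integrable (by norm_num)
  simpa only [mul_comm] using h

theorem IsWeakDeriv.congr {u v u' v' : ℝ → ℝ} (h : IsWeakDeriv u v)
    (hu : u' =ᵐ[perMeasure] u) (hv : v' =ᵐ[perMeasure] v) : IsWeakDeriv u' v' := by
  intro φ hφ hp
  have h1 : ∫ x, u' x * deriv φ x ∂perMeasure = ∫ x, u x * deriv φ x ∂perMeasure :=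
    integral_congr_ae (hu.mono fun x hx => by simp only [hx])
  have h2 : ∫ x, v' x * φ x ∂perMeasure = ∫ x, v x * φ x ∂perMeasure :=
    integral_congr_ae (hv.mono fun x hx => by simp only [hx])
  rw [h1, h2, h φ hφ hp]

/-- The graph of the periodic weak derivative in `L² × L²`, that is, all pairs `(u, u')`. -/
def h1Graph : Submodule ℝ (WithLp 2 (L2 × L2)) where
  carrier := {p | IsWeakDeriv p.fst p.snd}
  zero_mem' := by
    refine IsWeakDeriv.congr (u := fun _ => 0) (v := fun _ => 0) ?_
      (Lp.coeFn_zero ℝ 2 perMeasure) (Lp.coeFn_zero ℝ 2 perMeasure)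
    intro φ _ _
    simp
  add_mem' := by
    intro p q hp hq
    refine IsWeakDeriv.congr (u := fun x => p.fst x + q.fst x) (v := fun x => p.snd x + q.snd x)
      ?_ (Lp.coeFn_add _ _) (Lp.coeFn_add _ _)
    intro φ hφ hper
    have hd : Continuous (deriv φ) := hφ.continuous_deriv (by simp)
    simp only [add_mul]
    rw [integral_add (integrable_mul_continuous hd (Lp.memLp p.fst))
        (integrable_mul_continuous hd (Lp.memLp q.fst)),
      integral_add (integrable_mul_continuous hφ.continuous (Lp.memLp p.snd))
        (integrable_mul_continuous hφ.continuous (Lp.memLp q.snd)), hp φ hφ hper, hq φ hφ hper]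
    ring
  smul_mem' := by
    intro c p hp
    refine IsWeakDeriv.congr (u := fun x => c * p.fst x) (v := fun x => c * p.snd x)
      ?_ (Lp.coeFn_smul _ _) (Lp.coeFn_smul _ _)
    intro φ hφ hper
    simp only [mul_assoc]
    rw [integral_const_mul, integral_const_mul, hp φ hφ hper]
    ring

/-- The periodic Sobolev space `H¹_per(-π, π)` of real functions. A member is a pair `(u, u')` of
an `L²` function and its weak derivative; the norm is `(‖u‖²_{L²} + ‖u'‖²_{L²})^{1/2}`. -/
abbrev H1per : Type := h1Graph

/-- A representative of `u ∈ H¹_per`. -/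
def H1per.toFun (u : H1per) : ℝ → ℝ := u.1.fst

/-- A representative of the weak derivative of `u ∈ H¹_per`. -/
def H1per.weakDeriv (u : H1per) : ℝ → ℝ := u.1.snd

theorem H1per.memLp_toFun (u : H1per) : MemLp u.toFun 2 perMeasure := Lp.memLp u.1.fst

theorem H1per.memLp_weakDeriv (u : H1per) : MemLp u.weakDeriv 2 perMeasure := Lp.memLp u.1.snd

theorem H1per.isWeakDeriv (u : H1per) : IsWeakDeriv u.toFun u.weakDeriv := u.2

theorem memLp_mulSmooth_deriv {g : ℝ → ℝ} (hg : ContDiff ℝ ∞ g) (u : H1per) :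
    MemLp (fun x => deriv g x * u.toFun x + g x * u.weakDeriv x) 2 perMeasure :=
  (memLp_mul_continuous (hg.continuous_deriv (by simp)) u.memLp_toFun).add
    (memLp_mul_continuous hg.continuous u.memLp_weakDeriv)

theorem isWeakDeriv_mulSmooth {g : ℝ → ℝ} (hg : ContDiff ℝ ∞ g)
    (hper : Function.Periodic g (2 * π)) (u : H1per) :
    IsWeakDeriv (fun x => g x * u.toFun x)
      (fun x => deriv g x * u.toFun x + g x * u.weakDeriv x) := by
  intro φ hφ hφp
  have hgd : Continuous (deriv g) := hg.continuous_deriv (by simp)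
  have hφd : Continuous (deriv φ) := hφ.continuous_deriv (by simp)
  have hd : ∀ x, deriv (fun y => g y * φ y) x = deriv g x * φ x + g x * deriv φ x := fun x =>
    deriv_fun_mul (hg.differentiable (by simp) x) (hφ.differentiable (by simp) x)
  have key := u.isWeakDeriv (fun x => g x * φ x) (hg.mul hφ) (hper.mul hφp)
  have i1 : Integrable (fun x => u.toFun x * (deriv g x * φ x)) perMeasure :=
    integrable_mul_continuous (hgd.mul hφ.continuous) u.memLp_toFun
  have i2 : Integrable (fun x => u.toFun x * (g x * deriv φ x)) perMeasure :=
    integrable_mul_continuous (hg.continuous.mul hφd) u.memLp_toFun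
  have i3 : Integrable (fun x => u.weakDeriv x * (g x * φ x)) perMeasure :=
    integrable_mul_continuous (hg.continuous.mul hφ.continuous) u.memLp_weakDeriv
  simp only [hd, mul_add] at key
  rw [integral_add i1 i2] at key
  have e1 : ∫ x, g x * u.toFun x * deriv φ x ∂perMeasure
      = ∫ x, u.toFun x * (g x * deriv φ x) ∂perMeasure := by
    congr 1; ext x; ring
  have e2 : ∫ x, (deriv g x * u.toFun x + g x * u.weakDeriv x) * φ x ∂perMeasure
      = ∫ x, (u.toFun x * (deriv g x * φ x) + u.weakDeriv x * (g x * φ x)) ∂perMeasure := by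
    congr 1; ext x; ring
  rw [e1, e2, integral_add i1 i3]
  linarith

/-- The pointwise product `g u` of `u ∈ H¹_per` with a smooth `2π`-periodic function `g`. -/
def mulSmooth (g : ℝ → ℝ) (hg : ContDiff ℝ ∞ g) (hper : Function.Periodic g (2 * π))
    (u : H1per) : H1per :=
  ⟨WithLp.toLp 2
    ((memLp_mul_continuous hg.continuous u.memLp_toFun).toLp (fun x => g x * u.toFun x),
      (memLp_mulSmooth_deriv hg u).toLp
        (fun x => deriv g x * u.toFun x + g x * u.weakDeriv x)),
    (isWeakDeriv_mulSmooth hg hper u).congr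
      (MemLp.coeFn_toLp (memLp_mul_continuous hg.continuous u.memLp_toFun))
      (MemLp.coeFn_toLp (memLp_mulSmooth_deriv hg u))⟩

theorem mulSmooth_toFun (g : ℝ → ℝ) (hg : ContDiff ℝ ∞ g) (hper : Function.Periodic g (2 * π))
    (u : H1per) : (mulSmooth g hg hper u).toFun =ᵐ[perMeasure] fun x => g x * u.toFun x :=
  MemLp.coeFn_toLp (memLp_mul_continuous hg.continuous u.memLp_toFun)

/-- The spatial mean `⟨g⟩` over `(-π, π)`. -/
def mean (g : ℝ → ℝ) : ℝ := (2 * π)⁻¹ * ∫ x in (-π)..π, g x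

/-- The cosine Fourier coefficients. -/
def cosCoeff (u : ℝ → ℝ) (n : ℕ) : ℝ := π⁻¹ * ∫ x in (-π)..π, u x * cos (n * x)

/-- The sine Fourier coefficients. -/
def sinCoeff (u : ℝ → ℝ) (n : ℕ) : ℝ := π⁻¹ * ∫ x in (-π)..π, u x * sin (n * x)

/-- The projector `P_K` to the first `2K + 1` Fourier modes, as a trigonometric polynomial. -/
def fourierProj (K : ℕ) (u : H1per) (x : ℝ) : ℝ :=
  cosCoeff u.toFun 0 / 2 +
    ∑ n ∈ Finset.Icc 1 K, (cosCoeff u.toFun n * cos (n * x) + sinCoeff u.toFun n * sin (n * x))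

/-- `a` solves `a' = ½ [f(P_K u) - ⟨f(P_K u)⟩] a`, `a(-π) = 1`, on the real line. -/
def IsFactor (f : ℝ → ℝ) (K : ℕ) (u : H1per) (a : ℝ → ℝ) : Prop :=
  (∀ x, HasDerivAt a
    (1 / 2 * (f (fourierProj K u x) - mean (fun y => f (fourierProj K u y))) * a x) x) ∧
  a (-π) = 1

theorem contDiff_fourierProj (K : ℕ) (u : H1per) : ContDiff ℝ ∞ (fourierProj K u) := by
  unfold fourierProj
  fun_prop

theorem periodic_fourierProj (K : ℕ) (u : H1per) :
    Function.Periodic (fourierProj K u) (2 * π) := by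
  intro x
  unfold fourierProj
  simp only [mul_add, Real.cos_add_nat_mul_two_pi, Real.sin_add_nat_mul_two_pi]

/-- The primitive of the coefficient of the equation for the factor. -/
def factorExponent (f : ℝ → ℝ) (K : ℕ) (u : H1per) (x : ℝ) : ℝ :=
  ∫ s in (-π)..x, 1 / 2 * (f (fourierProj K u s) - mean (fun y => f (fourierProj K u y)))

theorem hasDerivAt_factorExponent {f : ℝ → ℝ} (hf : ContDiff ℝ ∞ f) (K : ℕ) (u : H1per) (x : ℝ) :
    HasDerivAt (factorExponent f K u)
      (1 / 2 * (f (fourierProj K u x) - mean (fun y => f (fourierProj K u y)))) x := by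
  have hc : Continuous fun s =>
      1 / 2 * (f (fourierProj K u s) - mean (fun y => f (fourierProj K u y))) := by
    have := hf.continuous.comp (contDiff_fourierProj K u).continuous
    exact continuous_const.mul (this.sub continuous_const)
  exact intervalIntegral.integral_hasDerivAt_right (hc.intervalIntegrable _ _)
    (hc.stronglyMeasurableAtFilter _ _) hc.continuousAt

/-- The equation for the factor is uniquely solvable. -/
theorem isFactor_iff {f : ℝ → ℝ} (hf : ContDiff ℝ ∞ f) (K : ℕ) (u : H1per) (a : ℝ → ℝ) :
    IsFactor f K u a ↔ a = fun x => exp (factorExponent f K u x) := by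
  constructor
  · rintro ⟨h, h0⟩
    have hG := hasDerivAt_factorExponent hf K u
    have hz : ∀ x, HasDerivAt (fun y => a y * exp (-factorExponent f K u y)) 0 x := by
      intro x
      refine ((h x).fun_mul (hG x).fun_neg.exp).congr_deriv ?_
      ring
    ext x
    have hx := is_const_of_deriv_eq_zero (fun y => (hz y).differentiableAt)
      (fun y => (hz y).deriv) x (-π)
    have h1 : factorExponent f K u (-π) = 0 := by simp [factorExponent]
    simp only [h0, h1, neg_zero, exp_zero, mul_one] at hx
    rw [exp_neg] at hx
    field_simp at hx
    exact hx
  · rintro rfl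
    refine ⟨fun x => ?_, by simp [factorExponent]⟩
    convert (hasDerivAt_factorExponent hf K u x).exp using 1
    ring

theorem existsUnique_isFactor {f : ℝ → ℝ} (hf : ContDiff ℝ ∞ f) (K : ℕ) (u : H1per) :
    ∃! a : ℝ → ℝ, IsFactor f K u a :=
  ⟨_, (isFactor_iff hf K u _).2 rfl, fun _ h => (isFactor_iff hf K u _).1 h⟩

/-- The factor `a(u)`: the unique solution of `a' = ½ [f(P_K u) - ⟨f(P_K u)⟩] a`, `a(-π) = 1`. -/
def factor (f : ℝ → ℝ) (hf : ContDiff ℝ ∞ f) (K : ℕ) (u : H1per) : ℝ → ℝ :=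
  Classical.choose (existsUnique_isFactor hf K u).exists

theorem isFactor_factor {f : ℝ → ℝ} (hf : ContDiff ℝ ∞ f) (K : ℕ) (u : H1per) :
    IsFactor f K u (factor f hf K u) :=
  Classical.choose_spec (existsUnique_isFactor hf K u).exists

theorem factor_eq_exp {f : ℝ → ℝ} (hf : ContDiff ℝ ∞ f) (K : ℕ) (u : H1per) :
    factor f hf K u = fun x => exp (factorExponent f K u x) :=
  (isFactor_iff hf K u _).1 (isFactor_factor hf K u)

theorem contDiff_factor_inv {f : ℝ → ℝ} (hf : ContDiff ℝ ∞ f) (K : ℕ) (u : H1per) :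
    ContDiff ℝ ∞ (fun x => (factor f hf K u x)⁻¹) := by
  have hG : ContDiff ℝ ∞ (factorExponent f K u) := by
    rw [contDiff_infty_iff_deriv]
    refine ⟨fun x => (hasDerivAt_factorExponent hf K u x).differentiableAt, ?_⟩
    rw [funext fun x => (hasDerivAt_factorExponent hf K u x).deriv]
    exact contDiff_const.mul ((hf.comp (contDiff_fourierProj K u)).sub contDiff_const)
  rw [factor_eq_exp]
  exact hG.exp.inv fun x => (exp_pos _).ne'

theorem periodic_factor_inv {f : ℝ → ℝ} (hf : ContDiff ℝ ∞ f) (K : ℕ) (u : H1per) :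
    Function.Periodic (fun x => (factor f hf K u x)⁻¹) (2 * π) := by
  have hF : Continuous fun s => f (fourierProj K u s) :=
    hf.continuous.comp (contDiff_fourierProj K u).continuous
  set m := mean (fun y => f (fourierProj K u y)) with hm
  have hc : Continuous fun s => 1 / 2 * (f (fourierProj K u s) - m) :=
    continuous_const.mul (hF.sub continuous_const)
  have hp : Function.Periodic (fun s => 1 / 2 * (f (fourierProj K u s) - m)) (2 * π) := by
    intro x
    simp only [periodic_fourierProj K u x]
  have h0 : ∫ s in (-π)..π, 1 / 2 * (f (fourierProj K u s) - m) = 0 := by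
    rw [intervalIntegral.integral_const_mul, intervalIntegral.integral_sub
      (hF.intervalIntegrable _ _) (continuous_const.intervalIntegrable _ _),
      intervalIntegral.integral_const, hm, mean]
    have := pi_pos.ne'
    simp only [smul_eq_mul]
    field_simp
    ring
  intro x
  have h1 : factorExponent f K u (x + 2 * π) = factorExponent f K u x := by
    have hx := hp.intervalIntegral_add_eq x (-π)
    rw [show -π + 2 * π = π by ring, h0] at hx
    unfold factorExponent
    rw [← intervalIntegral.integral_add_adjacent_intervals (hc.intervalIntegrable (-π) x)
      (hc.intervalIntegrable x (x + 2 * π)), hx, add_zero]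
  simp only [factor_eq_exp, h1]

/-- The nonlinear map `W(u) = a(u)⁻¹ u` on `H¹_per`. -/
def transform (f : ℝ → ℝ) (hf : ContDiff ℝ ∞ f) (K : ℕ) (u : H1per) : H1per :=
  mulSmooth (fun x => (factor f hf K u x)⁻¹) (contDiff_factor_inv hf K u)
    (periodic_factor_inv hf K u) u

theorem transform_toFun {f : ℝ → ℝ} (hf : ContDiff ℝ ∞ f) (K : ℕ) (u : H1per) :
    (transform f hf K u).toFun =ᵐ[perMeasure] fun x => (factor f hf K u x)⁻¹ * u.toFun x :=
  mulSmooth_toFun _ _ _ u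

/-- `W` restricts to a `C^∞` diffeomorphism of the open set `s` onto its (open) image, with
inverse `U`. -/
structure IsSmoothDiffeoOn {E : Type*} [NormedAddCommGroup E] [NormedSpace ℝ E]
    (W U : E → E) (s : Set E) : Prop where
  isOpen_source : IsOpen s
  isOpen_image : IsOpen (W '' s)
  leftInvOn : LeftInvOn U W s
  contDiffOn : ContDiffOn ℝ ∞ W s
  contDiffOn_inverse : ContDiffOn ℝ ∞ U (W '' s)

end PeriodicRDA

end

/-! Put F = sup |f| and w = W(u). The exponent g of a(u) is the primitive of r = ½[f(P_K u) − ⟨f(P_K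
u)⟩], so |r| ≤ F and |g| ≤ 2πF for every u and K. The relations w = e^{-g}u and u = e^{g}w then give
two-sided norm bounds with C = e^{2πF}(2 + F) (`norm_transform_le`, `norm_le_transform`). W is built
from bounded linear and bilinear maps and superposition operators on C[-π, π]. The index K enters
only through P_K : H¹ → C[-π, π], whose norms are bounded for K ≥ 1, so all derivatives of W are
bounded uniformly in K (`uniformCn_transform`).

The heart is the expansion estimate ‖u − u'‖ ≤ L‖w − w'‖ on B(R) for large K
(`exists_norm_sub_le_transform`). Were P_K the identity, substituting u = e^{g}w into the equation
for g would give a two-point problem for g alone, with data w, zero boundary values and an unknown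
constant (the mean). The difference of two solutions solves a linear problem of this kind, which is
integrated explicitly (`abs_le_of_two_point_problem`). The true P_K adds the source (1 − P_K)(u −
u'), of sup norm at most K^{-1/2}‖u − u'‖ (`norm_embed_sub_projCLM_le`); for K large depending on R
it is absorbed on the left.

Expansion makes DW(u) injective and bounded below. If h has no Fourier modes up to K, then a(u + th)
= a(u), so DW(u)h = a(u)⁻¹h. Thus DW(u) differs from an invertible operator by one of finite rank,
and injectivity gives surjectivity (`surjective_fderiv_transform`). The inverse function theorem
yields the open image and the smooth inverse, and DU = (DW ∘ U)⁻¹ carries uniform bounds from order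
to order (`UniformCn.exists_inverse`). The inner ball is covered by a connectedness argument
(`ball_subset_image_ball`). -/

/-! ### Families of maps that are `C^N` with uniform bounds -/

section UniformCn

variable {ι E F G H : Type*} [NormedAddCommGroup E] [NormedSpace ℝ E] [NormedAddCommGroup F]
  [NormedSpace ℝ F] [NormedAddCommGroup G] [NormedSpace ℝ G] [NormedAddCommGroup H]
  [NormedSpace ℝ H]

/-- The maps `g i` are `C^N` on the sets `s i`, and their derivatives of order at most `N` are
bounded uniformly in `i`. -/
structure UniformCn (N : ℕ) (s : ι → Set E) (g : ι → E → F) : Prop where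
  contDiffOn : ∀ i, ContDiffOn ℝ N (g i) (s i)
  bound : ∀ n ≤ N, ∃ M, ∀ i, ∀ x ∈ s i, ‖iteratedFDerivWithin ℝ n (g i) (s i) x‖ ≤ M

namespace UniformCn

variable {N : ℕ} {s : ι → Set E} {g : ι → E → F}

theorem of_le {m : ℕ} (h : UniformCn N s g) (hm : m ≤ N) : UniformCn m s g :=
  ⟨fun i => (h.contDiffOn i).of_le (by exact_mod_cast hm), fun n hn => h.bound n (hn.trans hm)⟩

theorem congr {g' : ι → E → F} (h : UniformCn N s g) (hg : ∀ i, EqOn (g' i) (g i) (s i)) :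
    UniformCn N s g' := by
  refine ⟨fun i => (h.contDiffOn i).congr (hg i), fun n hn => ?_⟩
  obtain ⟨M, hM⟩ := h.bound n hn
  exact ⟨M, fun i x hx => by rw [iteratedFDerivWithin_congr (hg i) hx]; exact hM i x hx⟩

theorem exists_norm_le (h : UniformCn N s g) : ∃ M, ∀ i, ∀ x ∈ s i, ‖g i x‖ ≤ M := by
  obtain ⟨M, hM⟩ := h.bound 0 (Nat.zero_le _)
  exact ⟨M, fun i x hx => by simpa using hM i x hx⟩

theorem zero_of_bound (hc : ∀ i, ContinuousOn (g i) (s i))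
    (hb : ∃ M, ∀ i, ∀ x ∈ s i, ‖g i x‖ ≤ M) : UniformCn 0 s g := by
  refine ⟨fun i => by simpa using hc i, fun n hn => ?_⟩
  obtain rfl : n = 0 := by omega
  simpa using hb

/-- The engine of every induction on the order: it is enough to exhibit a derivative that already
lies in the uniform class one order lower. -/
theorem succ_of_hasFDerivAt {g' : ι → E → E →L[ℝ] F} (hs : ∀ i, IsOpen (s i))
    (hg : ∀ i, ∀ x ∈ s i, HasFDerivAt (g i) (g' i x) x)
    (hb : ∃ M, ∀ i, ∀ x ∈ s i, ‖g i x‖ ≤ M) (h : UniformCn N s g') : UniformCn (N + 1) s g := by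
  have hE : ∀ i, EqOn (fderivWithin ℝ (g i) (s i)) (g' i) (s i) := fun i x hx =>
    (hg i x hx).hasFDerivWithinAt.fderivWithin ((hs i).uniqueDiffOn x hx)
  have h' : UniformCn N s fun i => fderivWithin ℝ (g i) (s i) := h.congr hE
  refine ⟨fun i => ?_, fun n hn => ?_⟩
  · rw [Nat.cast_add, Nat.cast_one, contDiffOn_succ_iff_fderivWithin (hs i).uniqueDiffOn]
    exact ⟨fun x hx => (hg i x hx).differentiableAt.differentiableWithinAt, by simp,
      h'.contDiffOn i⟩
  · cases n with
    | zero => simpa using hb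
    | succ n =>
      obtain ⟨M, hM⟩ := h'.bound n (by omega)
      refine ⟨M, fun i x hx => ?_⟩
      rw [← norm_iteratedFDerivWithin_fderivWithin (hs i).uniqueDiffOn hx]
      exact hM i x hx

theorem hasFDerivAt (h : UniformCn (N + 1) s g) (hs : ∀ i, IsOpen (s i)) (i : ι) {x : E}
    (hx : x ∈ s i) : HasFDerivAt (g i) (fderiv ℝ (g i) x) x :=
  (((h.contDiffOn i).contDiffAt ((hs i).mem_nhds hx)).differentiableAt (by simp)).hasFDerivAt

theorem fderiv (h : UniformCn (N + 1) s g) (hs : ∀ i, IsOpen (s i)) :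
    UniformCn N s fun i => fderiv ℝ (g i) := by
  have h' : UniformCn N s fun i => fderivWithin ℝ (g i) (s i) := by
    refine ⟨fun i => (h.contDiffOn i).fderivWithin (hs i).uniqueDiffOn (by simp), fun n hn => ?_⟩
    obtain ⟨M, hM⟩ := h.bound (n + 1) (by omega)
    refine ⟨M, fun i x hx => ?_⟩
    rw [norm_iteratedFDerivWithin_fderivWithin (hs i).uniqueDiffOn hx]
    exact hM i x hx
  exact h'.congr fun i x hx => (fderivWithin_of_isOpen (hs i) hx).symm

theorem const {c : ι → F} (hs : ∀ i, IsOpen (s i)) (hc : ∃ M, ∀ i, ‖c i‖ ≤ M) :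
    UniformCn N s fun i _ => c i := by
  refine ⟨fun i => contDiffOn_const, fun n _ => ?_⟩
  obtain ⟨M, hM⟩ := hc
  cases n with
  | zero => exact ⟨M, fun i x _ => by simpa using hM i⟩
  | succ n =>
    refine ⟨0, fun i x hx => ?_⟩
    rw [iteratedFDerivWithin_of_isOpen _ (hs i) hx, iteratedFDeriv_const_of_ne (by simp)]
    simp

/-- A bounded family of linear maps on uniformly bounded sets. -/
theorem clm {L : ι → E →L[ℝ] F} (hs : ∀ i, IsOpen (s i)) {R c : ℝ} (hR : ∀ i, ∀ x ∈ s i, ‖x‖ ≤ R)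
    (hL : ∀ i, ‖L i‖ ≤ c) : UniformCn N s fun i => L i := by
  have hb : ∃ M, ∀ i, ∀ x ∈ s i, ‖L i x‖ ≤ M := by
    refine ⟨c * R, fun i x hx => ((L i).le_opNorm x).trans ?_⟩
    exact mul_le_mul (hL i) (hR i x hx) (norm_nonneg _) ((norm_nonneg _).trans (hL i))
  exact (succ_of_hasFDerivAt hs (fun i x _ => (L i).hasFDerivAt) hb
    (const hs ⟨c, hL⟩)).of_le (Nat.le_succ N)

theorem clm_comp (L : F →L[ℝ] G) (h : UniformCn N s g) (hs : ∀ i, IsOpen (s i)) :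
    UniformCn N s fun i x => L (g i x) := by
  refine ⟨fun i => L.contDiff.comp_contDiffOn (h.contDiffOn i), fun n hn => ?_⟩
  obtain ⟨M, hM⟩ := h.bound n hn
  refine ⟨‖L‖ * M, fun i x hx => ?_⟩
  refine (L.norm_iteratedFDerivWithin_comp_left (h.contDiffOn i x hx) (hs i).uniqueDiffOn hx
    (by exact_mod_cast hn)).trans ?_
  exact mul_le_mul_of_nonneg_left (hM i x hx) (norm_nonneg _)

theorem bilinear (B : F →L[ℝ] G →L[ℝ] H) {k : ι → E → G} (hg : UniformCn N s g)
    (hk : UniformCn N s k) (hs : ∀ i, IsOpen (s i)) :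
    UniformCn N s fun i x => B (g i x) (k i x) := by
  refine ⟨fun i => (B.contDiff.comp_contDiffOn (hg.contDiffOn i)).clm_apply (hk.contDiffOn i),
    fun n hn => ?_⟩
  have h1 : ∀ j, ∃ M, j ≤ n → ∀ i, ∀ x ∈ s i, ‖iteratedFDerivWithin ℝ j (g i) (s i) x‖ ≤ M :=
    fun j => by
      by_cases hj : j ≤ n
      · obtain ⟨M, hM⟩ := hg.bound j (hj.trans hn)
        exact ⟨M, fun _ => hM⟩
      · exact ⟨0, fun h => absurd h hj⟩
  have h2 : ∀ j, ∃ M, j ≤ n → ∀ i, ∀ x ∈ s i, ‖iteratedFDerivWithin ℝ j (k i) (s i) x‖ ≤ M :=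
    fun j => by
      by_cases hj : j ≤ n
      · obtain ⟨M, hM⟩ := hk.bound j (hj.trans hn)
        exact ⟨M, fun _ => hM⟩
      · exact ⟨0, fun h => absurd h hj⟩
  choose M₁ hM₁ using h1
  choose M₂ hM₂ using h2
  refine ⟨‖B‖ * ∑ j ∈ Finset.range (n + 1), (n.choose j : ℝ) * M₁ j * M₂ (n - j),
    fun i x hx => ?_⟩
  refine (B.norm_iteratedFDerivWithin_le_of_bilinear (hg.contDiffOn i) (hk.contDiffOn i)
    (hs i).uniqueDiffOn hx (by exact_mod_cast hn)).trans ?_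
  refine mul_le_mul_of_nonneg_left (Finset.sum_le_sum fun j hj => ?_) (by positivity)
  have hj' : j ≤ n := by simpa [Nat.lt_succ_iff] using hj
  have hA := hM₁ j hj' i x hx
  exact mul_le_mul (mul_le_mul_of_nonneg_left hA (by positivity))
    (hM₂ (n - j) (Nat.sub_le _ _) i x hx) (norm_nonneg _)
    (mul_nonneg (by positivity) ((norm_nonneg _).trans hA))

theorem comp {t : ι → Set F} {k : ι → F → G} (hk : UniformCn N t k) (hg : UniformCn N s g)
    (ht : ∀ i, IsOpen (t i)) (hs : ∀ i, IsOpen (s i)) (hst : ∀ i, MapsTo (g i) (s i) (t i)) :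
    UniformCn N s fun i x => k i (g i x) := by
  refine ⟨fun i => (hk.contDiffOn i).comp (hg.contDiffOn i) (hst i), fun n hn => ?_⟩
  have h1 : ∀ j, ∃ M, j ≤ n → ∀ i, ∀ x ∈ s i, ‖iteratedFDerivWithin ℝ j (g i) (s i) x‖ ≤ M :=
    fun j => by
      by_cases hj : j ≤ n
      · obtain ⟨M, hM⟩ := hg.bound j (hj.trans hn)
        exact ⟨M, fun _ => hM⟩
      · exact ⟨0, fun h => absurd h hj⟩
  have h2 : ∀ j, ∃ M, j ≤ n → ∀ i, ∀ x ∈ t i, ‖iteratedFDerivWithin ℝ j (k i) (t i) x‖ ≤ M :=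
    fun j => by
      by_cases hj : j ≤ n
      · obtain ⟨M, hM⟩ := hk.bound j (hj.trans hn)
        exact ⟨M, fun _ => hM⟩
      · exact ⟨0, fun h => absurd h hj⟩
  choose M₁ hM₁ using h1
  choose M₂ hM₂ using h2
  -- The composition estimate wants the j-th derivative of the inner map bounded by D ^ j. The
  -- summand 1 ensures D ≥ 1, so that D ≤ D ^ j for j ≥ 1.
  set D : ℝ := 1 + ∑ j ∈ Finset.range (n + 1), |M₁ j|
  set C : ℝ := ∑ j ∈ Finset.range (n + 1), |M₂ j|
  have hle : ∀ (f : ℕ → ℝ) j, j ≤ n → f j ≤ ∑ j ∈ Finset.range (n + 1), |f j| := fun f j hj =>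
    (le_abs_self _).trans (Finset.single_le_sum (f := fun j => |f j|) (fun _ _ => abs_nonneg _)
      (Finset.mem_range.2 (Nat.lt_succ_of_le hj)))
  have hD : 1 ≤ D := le_add_of_nonneg_right (Finset.sum_nonneg fun _ _ => abs_nonneg _)
  refine ⟨n.factorial * C * D ^ n, fun i x hx => ?_⟩
  refine norm_iteratedFDerivWithin_comp_le (hk.contDiffOn i) (hg.contDiffOn i)
    (by exact_mod_cast hn) (ht i).uniqueDiffOn (hs i).uniqueDiffOn (hst i) hx
    (fun j hj => (hM₂ j hj i _ (hst i hx)).trans (hle M₂ j hj)) (fun j hj1 hj => ?_)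
  calc _ ≤ M₁ j := hM₁ j hj i x hx
    _ ≤ D := (hle M₁ j hj).trans (by simp [D])
    _ ≤ D ^ j := le_self_pow₀ hD (by omega)

theorem add {k : ι → E → F} (hg : UniformCn N s g) (hk : UniformCn N s k)
    (hs : ∀ i, IsOpen (s i)) : UniformCn N s fun i x => g i x + k i x := by
  refine ⟨fun i => (hg.contDiffOn i).add (hk.contDiffOn i), fun n hn => ?_⟩
  obtain ⟨M, hM⟩ := hg.bound n hn
  obtain ⟨M', hM'⟩ := hk.bound n hn
  refine ⟨M + M', fun i x hx => ?_⟩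
  have := fun_iteratedFDerivWithin_add_apply (𝕜 := ℝ) (i := n)
    ((hg.contDiffOn i x hx).of_le (by exact_mod_cast hn))
    ((hk.contDiffOn i x hx).of_le (by exact_mod_cast hn)) (hs i).uniqueDiffOn hx
  rw [this]
  exact (norm_add_le _ _).trans (add_le_add (hM i x hx) (hM' i x hx))

/-- Pointwise inverses in a Banach algebra, if bounded, inherit uniform regularity. -/
theorem inverse {𝔸 : Type*} [NormedRing 𝔸] [NormedAlgebra ℝ 𝔸] [CompleteSpace 𝔸]
    {a b : ι → E → 𝔸} (ha : UniformCn N s a) (hs : ∀ i, IsOpen (s i))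
    (hab : ∀ i, ∀ x ∈ s i, a i x * b i x = 1) (hba : ∀ i, ∀ x ∈ s i, b i x * a i x = 1)
    (hb : ∃ M, ∀ i, ∀ x ∈ s i, ‖b i x‖ ≤ M) : UniformCn N s b := by
  have hinv : ∀ i, EqOn (b i) (fun x => Ring.inverse (a i x)) (s i) := fun i x hx =>
    (Ring.inverse_unit ⟨a i x, b i x, hab i x hx, hba i x hx⟩).symm
  induction N with
  | zero =>
    refine zero_of_bound (fun i => ContinuousOn.congr (fun x hx => ?_) (hinv i)) hb
    exact ContinuousAt.comp_continuousWithinAt (f := a i) (NormedRing.inverse_continuousAt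
      (⟨a i x, b i x, hab i x hx, hba i x hx⟩ : 𝔸ˣ)) ((ha.contDiffOn i).continuousOn x hx)
  | succ N ih =>
    have hbN := ih (ha.of_le (Nat.le_succ N))
    have hd := ha.fderiv hs
    -- The derivative of a⁻¹ is h ↦ −b (a' h) b: a trilinear expression in a' and b, hence of class
    -- N by the induction hypothesis.
    have hm := ((hbN.bilinear (ContinuousLinearMap.mulLeftRight ℝ 𝔸) hbN hs).clm_comp
      (-ContinuousLinearMap.id ℝ _) hs).bilinear
      (ContinuousLinearMap.compL ℝ E 𝔸 𝔸) hd hs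
    refine succ_of_hasFDerivAt hs (fun i x hx => ?_) hb hm
    have h1 := (hasFDerivAt_ringInverse (𝕜 := ℝ)
      (⟨a i x, b i x, hab i x hx, hba i x hx⟩ : 𝔸ˣ)).comp x (ha.hasFDerivAt hs i hx)
    refine (h1.congr_of_eventuallyEq ?_)
    filter_upwards [(hs i).mem_nhds hx] with y hy using hinv i hy

end UniformCn

end UniformCn

/-! ### Inverse functions with uniform bounds -/

/-- Here S⁻¹T = 1 + D, where D vanishes on ker P and so has finite rank. The range of D is invariant
under 1 + D, and an injective endomorphism of a finite-dimensional space is onto. This is the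
algebraic form of the statement that the index is zero. -/
theorem LinearMap.surjective_of_injective_of_eqOn_ker {E V : Type*} [AddCommGroup E] [Module ℝ E]
    [AddCommGroup V] [Module ℝ V] (P : E →ₗ[ℝ] V) [FiniteDimensional ℝ (LinearMap.range P)]
    {S T : E →ₗ[ℝ] E} (hS : Function.Bijective S) (hT : Function.Injective T)
    (hST : ∀ x, P x = 0 → T x = S x) : Function.Surjective T := by
  set e := LinearEquiv.ofBijective S hS
  set D : E →ₗ[ℝ] E := e.symm.toLinearMap ∘ₗ T - LinearMap.id
  have hD : ∀ x, D x = e.symm (T x) - x := fun x => rfl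
  have hker : LinearMap.ker P ≤ LinearMap.ker D := fun x hx => by
    have : T x = e x := hST x hx
    simp [hD, this]
  have hfin : FiniteDimensional ℝ (LinearMap.range D) := by
    have h1 : FiniteDimensional ℝ (E ⧸ LinearMap.ker P) :=
      (P.quotKerEquivRange).symm.finiteDimensional
    have h2 := Submodule.range_liftQ (LinearMap.ker P) D hker
    rw [← h2]
    infer_instance
  have key : ∀ y, ∃ x, x + D x = y := by
    intro y
    set V' := LinearMap.range D
    have hmaps : ∀ v ∈ V', (LinearMap.id + D : E →ₗ[ℝ] E) v ∈ V' := fun v hv =>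
      V'.add_mem hv (LinearMap.mem_range_self D v)
    set A : V' →ₗ[ℝ] V' := (LinearMap.id + D : E →ₗ[ℝ] E).restrict hmaps
    have hinj : Function.Injective A := by
      rw [injective_iff_map_eq_zero]
      intro v hv
      have h1 : (v : E) + D v = 0 := congrArg Subtype.val hv
      rw [hD, add_sub_cancel, LinearEquiv.map_eq_zero_iff] at h1
      exact Subtype.ext (hT (by simpa using h1))
    obtain ⟨v, hv⟩ := LinearMap.surjective_of_injective hinj
      ⟨-D y, V'.neg_mem (LinearMap.mem_range_self D y)⟩
    have h1 : (v : E) + D v = -D y := congrArg Subtype.val hv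
    -- With v in the range of D chosen so that v + Dv = −Dy, the vector y + v solves x + Dx = y.
    refine ⟨y + v, ?_⟩
    rw [map_add, show y + (v : E) + (D y + D v) = y + D y + (v + D v) by abel, h1]
    abel
  intro y
  obtain ⟨x, hx⟩ := key (e.symm y)
  rw [hD, add_sub_cancel] at hx
  exact ⟨x, e.symm.injective hx⟩

section InverseFunction

variable {ι E : Type*} [NormedAddCommGroup E] [NormedSpace ℝ E]

/-- The expansion inequality, divided by |t| along u + th, passes to the limit t → 0. -/
theorem HasFDerivAt.norm_le_of_norm_sub_le {W : E → E} {W' : E →L[ℝ] E} {s : Set E} {u : E} {L : ℝ}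
    (hW : HasFDerivAt W W' u) (hs : s ∈ nhds u)
    (hL : ∀ v ∈ s, ‖v - u‖ ≤ L * ‖W v - W u‖) (h : E) : ‖h‖ ≤ L * ‖W' h‖ := by
  have hl := hW.hasLineDerivAt h
  have h1 := hl.tendsto_slope_zero.norm.const_mul L
  refine ge_of_tendsto h1 ?_
  have hc : Filter.Tendsto (fun t : ℝ => u + t • h) (nhdsWithin 0 {0}ᶜ) (nhds u) := by
    have : Continuous fun t : ℝ => u + t • h := by fun_prop
    simpa using (this.tendsto 0).mono_left nhdsWithin_le_nhds
  filter_upwards [hc hs, self_mem_nhdsWithin] with t ht ht0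
  have h2 := hL _ ht
  have ht0' : 0 < |t| := abs_pos.2 ht0
  rw [norm_smul, norm_inv, Real.norm_eq_abs]
  rw [add_sub_cancel_left, norm_smul, Real.norm_eq_abs] at h2
  calc ‖h‖ = |t|⁻¹ * (|t| * ‖h‖) := by field_simp
    _ ≤ |t|⁻¹ * (L * ‖W (u + t • h) - W u‖) := by gcongr
    _ = _ := by ring

variable [CompleteSpace E] {s : Set E} {W : ι → E → E} {L : ℝ}

/-- A family of uniformly smooth maps that are uniformly expanding with surjective derivatives has
uniformly smooth inverses. -/
theorem UniformCn.exists_inverse (hW : ∀ N, UniformCn N (fun _ : ι => s) W) (hs : IsOpen s)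
    (hb : Bornology.IsBounded s)
    (hL : ∀ i, ∀ u ∈ s, ∀ v ∈ s, ‖u - v‖ ≤ L * ‖W i u - W i v‖)
    (hsurj : ∀ i, ∀ u ∈ s, Function.Surjective (_root_.fderiv ℝ (W i) u)) :
    ∃ U : ι → E → E, (∀ i, IsOpen (W i '' s)) ∧ (∀ i, LeftInvOn (U i) (W i) s) ∧
      ∀ N, UniformCn N (fun i => W i '' s) U := by
  have hinj : ∀ i, InjOn (W i) s := fun i u hu v hv huv => by
    have := hL i u hu v hv
    rw [huv, sub_self, norm_zero, mul_zero] at this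
    exact sub_eq_zero.1 (norm_le_zero_iff.1 this)
  have hlow : ∀ i, ∀ u ∈ s, ∀ h, ‖h‖ ≤ L * ‖_root_.fderiv ℝ (W i) u h‖ := fun i u hu h =>
    ((hW 1).hasFDerivAt (fun _ => hs) i hu).norm_le_of_norm_sub_le (hs.mem_nhds hu)
      (fun v hv => hL i v hv u hu) h
  have hequiv : ∀ i, ∀ u : s, ∃ e : E ≃L[ℝ] E, (e : E →L[ℝ] E) = _root_.fderiv ℝ (W i) u := by
    intro i u
    refine ⟨ContinuousLinearEquiv.ofBijective (_root_.fderiv ℝ (W i) u) ?_ ?_,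
      ContinuousLinearEquiv.coe_ofBijective _ _ _⟩
    · rw [LinearMap.ker_eq_bot']
      intro h hh
      have h1 := hlow i u u.2 h
      have h2 : _root_.fderiv ℝ (W i) u h = 0 := hh
      rw [h2, norm_zero, mul_zero] at h1
      exact norm_le_zero_iff.1 h1
    · exact LinearMap.range_eq_top.2 (hsurj i u u.2)
  choose e he using hequiv
  have hstrict : ∀ i, ∀ u : s, HasStrictFDerivAt (W i) (e i u : E →L[ℝ] E) u := fun i u => by
    rw [he]
    exact (((hW 1).contDiffOn i).contDiffAt (hs.mem_nhds u.2)).hasStrictFDerivAt (by simp)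
  have hopen : ∀ i, IsOpen (W i '' s) := fun i => by
    rw [isOpen_iff_mem_nhds]
    rintro _ ⟨u, hu, rfl⟩
    rw [← (hstrict i ⟨u, hu⟩).map_nhds_eq_of_equiv]
    exact Filter.image_mem_map (hs.mem_nhds hu)
  classical
  set U : ι → E → E := fun i w => if h : w ∈ W i '' s then h.choose else 0 with hUdef
  have hUmem : ∀ i, ∀ w ∈ W i '' s, U i w ∈ s ∧ W i (U i w) = w := fun i w hw => by
    simp only [hUdef, dif_pos hw]
    exact hw.choose_spec
  have hleft : ∀ i, LeftInvOn (U i) (W i) s := fun i u hu =>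
    hinj i (hUmem i _ (mem_image_of_mem _ hu)).1 hu (hUmem i _ (mem_image_of_mem _ hu)).2
  have hULip : ∀ i, ∀ w ∈ W i '' s, ∀ z ∈ W i '' s, ‖U i w - U i z‖ ≤ L * ‖w - z‖ :=
    fun i w hw z hz => by
      have := hL i _ (hUmem i w hw).1 _ (hUmem i z hz).1
      rwa [(hUmem i w hw).2, (hUmem i z hz).2] at this
  have hUcont : ∀ i, ContinuousOn (U i) (W i '' s) := fun i => by
    refine LipschitzOnWith.continuousOn (K := L.toNNReal) ?_
    refine LipschitzOnWith.of_dist_le_mul fun w hw z hz => ?_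
    rw [dist_eq_norm, dist_eq_norm]
    exact (hULip i w hw z hz).trans
      (mul_le_mul_of_nonneg_right (Real.le_coe_toNNReal L) (norm_nonneg _))
  have hder : ∀ i, ∀ w, ∀ hw : w ∈ W i '' s,
      HasFDerivAt (U i) ((e i ⟨U i w, (hUmem i w hw).1⟩).symm : E →L[ℝ] E) w := fun i w hw => by
    refine HasFDerivAt.of_local_left_inverse ((hUcont i).continuousAt ((hopen i).mem_nhds hw))
      (hstrict i ⟨U i w, (hUmem i w hw).1⟩).hasFDerivAt ?_
    filter_upwards [(hopen i).mem_nhds hw] with z hz using (hUmem i z hz).2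
  have hbdd : ∃ M, ∀ i, ∀ w ∈ W i '' s, ‖U i w‖ ≤ M := by
    obtain ⟨M, hM⟩ := hb.exists_norm_le
    exact ⟨M, fun i w hw => hM _ (hUmem i w hw).1⟩
  refine ⟨U, hopen, hleft, fun N => ?_⟩
  induction N with
  | zero => exact zero_of_bound hUcont hbdd
  | succ N ih =>
    set B : ι → E → E →L[ℝ] E := fun i w => if h : w ∈ W i '' s then
      ((e i ⟨U i w, (hUmem i w h).1⟩).symm : E →L[ℝ] E) else 0
    have hB : ∀ i w, ∀ hw : w ∈ W i '' s,
        B i w = ((e i ⟨U i w, (hUmem i w hw).1⟩).symm : E →L[ℝ] E) := fun i w hw => dif_pos hw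
    -- DU(w) is the inverse of DW(U(w)). The latter is of class N by composition with the induction
    -- hypothesis, and its inverse is bounded by |L| thanks to expansion.
    have hA : UniformCn N (fun i => W i '' s) fun i w => _root_.fderiv ℝ (W i) (U i w) :=
      ((hW (N + 1)).fderiv fun _ => hs).comp ih (fun _ => hs) hopen fun i w hw => (hUmem i w hw).1
    refine succ_of_hasFDerivAt hopen (g' := B) (fun i w hw => ?_) hbdd
      (hA.inverse hopen (fun i w hw => ?_) (fun i w hw => ?_) ⟨|L|, fun i w hw => ?_⟩)
    · rw [hB i w hw]
      exact hder i w hw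
    · rw [hB i w hw, ← he i ⟨U i w, (hUmem i w hw).1⟩]
      ext x
      simp
    · rw [hB i w hw, ← he i ⟨U i w, (hUmem i w hw).1⟩]
      ext x
      simp
    · rw [hB i w hw]
      refine ContinuousLinearMap.opNorm_le_bound _ (abs_nonneg _) fun x => ?_
      have := hlow i _ (hUmem i w hw).1 ((e i ⟨U i w, (hUmem i w hw).1⟩).symm x)
      rw [← he i ⟨U i w, (hUmem i w hw).1⟩] at this
      refine this.trans ?_
      simp only [ContinuousLinearEquiv.coe_coe, ContinuousLinearEquiv.apply_symm_apply]
      exact mul_le_mul_of_nonneg_right (le_abs_self L) (norm_nonneg _)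

/-- An expanding map with open image which does not contract the norm too much covers a ball. -/
theorem ball_subset_image_ball {W : E → E} {R C : ℝ} (hR : 0 < R) (hC : 0 < C)
    (hcont : ContinuousOn W (Metric.ball 0 R)) (hopen : IsOpen (W '' Metric.ball 0 R))
    (hL : ∀ u ∈ Metric.ball 0 R, ∀ v ∈ Metric.ball 0 R, ‖u - v‖ ≤ L * ‖W u - W v‖)
    (h0 : W 0 = 0) (hWC : ∀ u, ‖u‖ ≤ C * ‖W u‖) :
    Metric.ball 0 (C⁻¹ * R) ⊆ W '' Metric.ball 0 R := by
  -- The image is open and meets the connected ball at 0, so it contains the ball as soon as it is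
  -- relatively closed in it. Expansion turns a convergent sequence of images into a Cauchy sequence
  -- of preimages.
  refine (convex_ball (0 : E) (C⁻¹ * R)).isPreconnected.subset_of_closure_inter_subset hopen
    ⟨0, Metric.mem_ball_self (by positivity), 0, Metric.mem_ball_self hR, h0⟩ ?_
  rintro w ⟨hw, hwb⟩
  obtain ⟨z, hz, hzw⟩ := mem_closure_iff_seq_limit.1 hw
  choose u hu huz using hz
  have hcau : CauchySeq u := by
    have hzc := hzw.cauchySeq
    rw [Metric.cauchySeq_iff] at hzc ⊢
    intro ε hε
    obtain ⟨n, hn⟩ := hzc (ε / (|L| + 1)) (by positivity)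
    refine ⟨n, fun i hi j hj => ?_⟩
    have h1 := hL _ (hu i) _ (hu j)
    have h2 := hn i hi j hj
    rw [huz, huz] at h1
    rw [dist_eq_norm] at h2 ⊢
    rw [lt_div_iff₀ (by positivity)] at h2
    calc _ ≤ _ := h1
      _ ≤ ‖z i - z j‖ * (|L| + 1) := by
        nlinarith [norm_nonneg (z i - z j), le_abs_self L]
      _ < ε := h2
  obtain ⟨v, hv⟩ := cauchySeq_tendsto_of_complete hcau
  -- The limit of the preimages could only escape through the boundary sphere; ‖v‖ ≤ C‖w‖ < R
  -- excludes this and explains the radius C⁻¹R.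
  have hvR : v ∈ Metric.ball 0 R := by
    have h1 : ‖v‖ ≤ C * ‖w‖ := by
      refine le_of_tendsto_of_tendsto hv.norm (hzw.norm.const_mul C)
        (Filter.Eventually.of_forall fun n => ?_)
      simpa only [huz] using hWC (u n)
    rw [mem_ball_zero_iff] at hwb ⊢
    calc _ ≤ _ := h1
      _ < C * (C⁻¹ * R) := by gcongr
      _ = R := by field_simp
  refine ⟨v, hvR, tendsto_nhds_unique ?_ hzw⟩
  have := ((hcont.continuousAt (Metric.isOpen_ball.mem_nhds hvR)).tendsto.comp hv)
  simpa [Function.comp_def, huz] using this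

end InverseFunction

/-! ### Superposition operators and a scalar equation -/

/-- The coefficient is the mean of h' over the segment from b to a. It makes differences of
nonlinear terms exactly linear, with a continuous bounded coefficient. -/
theorem ContDiff.exists_divided_difference {h : ℝ → ℝ} (hh : ContDiff ℝ 1 h) {L : ℝ}
    (hL : ∀ x, |deriv h x| ≤ L) : ∃ k : ℝ → ℝ → ℝ, Continuous (Function.uncurry k) ∧
      (∀ a b, h a - h b = k a b * (a - b)) ∧ ∀ a b, |k a b| ≤ L := by
  have hd : Continuous (deriv h) := hh.continuous_deriv le_rfl
  refine ⟨fun a b => ∫ t in (0 : ℝ)..1, deriv h (b + t * (a - b)), ?_, fun a b => ?_,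
    fun a b => ?_⟩
  · exact intervalIntegral.continuous_parametric_intervalIntegral_of_continuous' (by fun_prop) _ _
  · have hder : ∀ t ∈ uIcc (0 : ℝ) 1, HasDerivAt (fun t => h (b + t * (a - b)))
        (deriv h (b + t * (a - b)) * (a - b)) t := fun t _ => by
      have h1 := ((hh.differentiable one_ne_zero) (b + t * (a - b))).hasDerivAt
      have h2 : HasDerivAt (fun t => b + t * (a - b)) (a - b) t := by
        simpa using ((hasDerivAt_id t).mul_const (a - b)).const_add b
      exact h1.comp t h2
    have hint := intervalIntegral.integral_eq_sub_of_hasDerivAt hder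
      (Continuous.intervalIntegrable (by fun_prop) _ _)
    rw [intervalIntegral.integral_mul_const] at hint
    rw [hint]
    simp
  · have := intervalIntegral.norm_integral_le_of_norm_le_const (a := (0 : ℝ)) (b := 1)
      (f := fun t => deriv h (b + t * (a - b))) (C := L) fun t _ => hL _
    simpa using this

section Superposition

variable {α : Type*} [TopologicalSpace α] [CompactSpace α]

/-- The superposition operator `v ↦ h ∘ v`. -/
def superposition (h : ℝ → ℝ) (hh : Continuous h) (v : C(α, ℝ)) : C(α, ℝ) := ⟨fun x => h (v x), by
  fun_prop⟩

variable (α) in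
/-- Multiplication of continuous functions. -/
noncomputable def mulCLM : C(α, ℝ) →L[ℝ] C(α, ℝ) →L[ℝ] C(α, ℝ) := ContinuousLinearMap.mul ℝ C(α, ℝ)

theorem HasCompactSupport.exists_abs_le {h : ℝ → ℝ} (hs : HasCompactSupport h)
    (hh : Continuous h) : ∃ c, 0 ≤ c ∧ ∀ x, |h x| ≤ c := by
  obtain ⟨c, hc⟩ := hs.exists_bound_of_continuous hh
  exact ⟨c, (norm_nonneg _).trans (hc 0), hc⟩

theorem norm_superposition_le {h : ℝ → ℝ} (hh : Continuous h) {c : ℝ} (hc0 : 0 ≤ c)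
    (hc : ∀ x, |h x| ≤ c) (v : C(α, ℝ)) : ‖superposition h hh v‖ ≤ c :=
  (ContinuousMap.norm_le _ hc0).2 fun _ => hc _

theorem abs_sub_sub_deriv_mul_le {h : ℝ → ℝ} (hh : ContDiff ℝ 2 h) {c : ℝ}
    (hc : ∀ x, |deriv (deriv h) x| ≤ c) (a b : ℝ) :
    |h (a + b) - h a - deriv h a * b| ≤ c * b ^ 2 := by
  have hd1 : ContDiff ℝ 1 (deriv h) := (contDiff_succ_iff_deriv (n := 1).1 hh).2.2
  have hlip : ∀ x y, |deriv h x - deriv h y| ≤ c * |x - y| := fun x y =>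
    Convex.norm_image_sub_le_of_norm_deriv_le (s := univ) (f := deriv h)
      (fun x _ => hd1.differentiable one_ne_zero x) (fun x _ => hc x) convex_univ
      (mem_univ y) (mem_univ x)
  have hc0 : 0 ≤ c := (abs_nonneg _).trans (hc 0)
  have hder : ∀ t ∈ uIcc a (a + b), HasDerivWithinAt (fun t => h t - deriv h a * t)
      (deriv h t - deriv h a) (uIcc a (a + b)) t := fun t _ => by
    have h1 := ((hh.differentiable two_ne_zero) t).hasDerivAt
    have h2 := (hasDerivAt_id t).const_mul (deriv h a)
    simpa using (h1.fun_sub h2).hasDerivWithinAt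
  have hbd : ∀ t ∈ uIcc a (a + b), ‖deriv h t - deriv h a‖ ≤ c * |b| := fun t ht => by
    refine (hlip t a).trans (mul_le_mul_of_nonneg_left ?_ hc0)
    simpa using abs_sub_left_of_mem_uIcc ht
  have := (convex_uIcc a (a + b)).norm_image_sub_le_of_norm_hasDerivWithin_le hder hbd
    left_mem_uIcc right_mem_uIcc
  rw [Real.norm_eq_abs, add_sub_cancel_left, Real.norm_eq_abs, mul_assoc, ← sq, sq_abs] at this
  convert this using 2
  ring

/-- Since h'' is bounded on the whole line, the pointwise second-order Taylor remainder is uniform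
in x, hence O(‖w‖²) in sup norm. -/
theorem hasFDerivAt_superposition {h : ℝ → ℝ} (hh : ContDiff ℝ ∞ h) (hs : HasCompactSupport h)
    (v : C(α, ℝ)) : HasFDerivAt (superposition h hh.continuous)
      (mulCLM α
        (superposition (deriv h) (hh.continuous_deriv (by simp)) v)) v := by
  have hd1 : ContDiff ℝ ∞ (deriv h) := (contDiff_infty_iff_deriv.1 hh).2
  obtain ⟨c, hc0, hc⟩ := hs.deriv.deriv.exists_abs_le (hd1.continuous_deriv (by simp))
  rw [hasFDerivAt_iff_isLittleO_nhds_zero]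
  refine Asymptotics.IsBigO.trans_isLittleO ?_ (Asymptotics.isLittleO_norm_pow_id one_lt_two)
  refine Asymptotics.IsBigO.of_bound c (Filter.Eventually.of_forall fun w => ?_)
  refine (ContinuousMap.norm_le _ (by positivity)).2 fun x => ?_
  rw [norm_pow, norm_norm]
  have h1 := abs_sub_sub_deriv_mul_le (by exact_mod_cast contDiff_infty.1 hh 2) hc (v x) (w x)
  refine h1.trans (mul_le_mul_of_nonneg_left ?_ hc0)
  rw [← sq_abs]
  exact pow_le_pow_left₀ (abs_nonneg _) (w.norm_coe_le_norm x) 2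

/-- The derivative is multiplication by the superposition of h', and h' is again smooth with compact
support. This is why the induction on N runs over all h at once. -/
theorem uniformCn_superposition {ι : Type*} (N : ℕ) {h : ℝ → ℝ} (hh : ContDiff ℝ ∞ h)
    (hs : HasCompactSupport h) : UniformCn N (fun _ : ι => univ)
      (fun _ => superposition (α := α) h hh.continuous) := by
  have hb : ∀ {h : ℝ → ℝ} (hh : ContDiff ℝ ∞ h) (_ : HasCompactSupport h), ∃ M, ∀ _ : ι,
      ∀ v ∈ (univ : Set C(α, ℝ)), ‖superposition h hh.continuous v‖ ≤ M := fun hh hs => by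
    obtain ⟨c, hc0, hc⟩ := hs.exists_abs_le hh.continuous
    exact ⟨c, fun _ v _ => norm_superposition_le hh.continuous hc0 hc v⟩
  induction N generalizing h with
  | zero =>
    exact .zero_of_bound (fun _ v _ =>
      (hasFDerivAt_superposition hh hs v).continuousAt.continuousWithinAt) (hb hh hs)
  | succ N ih =>
    have h1 := UniformCn.clm_comp (F := C(α, ℝ)) (G := C(α, ℝ) →L[ℝ] C(α, ℝ)) (mulCLM α)
      (ih (contDiff_infty_iff_deriv.1 hh).2 hs.deriv) fun _ => isOpen_univ
    exact .succ_of_hasFDerivAt (fun _ => isOpen_univ)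
      (fun _ v _ => hasFDerivAt_superposition hh hs v) (hb hh hs) h1

/-- A smooth compactly supported function which agrees with `exp` on a bounded interval. -/
theorem exists_hasCompactSupport_eq_exp (B : ℝ) : ∃ h : ℝ → ℝ, ContDiff ℝ ∞ h ∧
    HasCompactSupport h ∧ ∀ x, |x| ≤ B → h x = exp x := by
  let χ : ContDiffBump (0 : ℝ) := ⟨|B| + 1, |B| + 2, by positivity, by linarith⟩
  refine ⟨fun x => χ x * exp x, χ.contDiff.mul contDiff_exp, χ.hasCompactSupport.mul_right,
    fun x hx => ?_⟩
  have : χ x = 1 := χ.one_of_mem_closedBall (by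
    rw [mem_closedBall_zero_iff, Real.norm_eq_abs]
    exact hx.trans ((le_abs_self B).trans (by simp [χ])))
  simp [this]

end Superposition

/-- The two-point problem `g' = p g + r - c`, `g(a) = g(b) = 0` with unknown constant `c`. -/
theorem abs_le_of_two_point_problem {a b : ℝ} (hab : a < b) {g p r : ℝ → ℝ} {c P ρ : ℝ}
    (hp : Continuous p) (hr : Continuous r)
    (hg : ∀ x ∈ Icc a b, HasDerivAt g (p x * g x + r x - c) x) (hga : g a = 0) (hgb : g b = 0)
    (hP : ∀ x ∈ Icc a b, |p x| ≤ P) (hρ : ∀ x ∈ Icc a b, |r x| ≤ ρ) :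
    |c| ≤ ρ ∧ ∀ x ∈ Icc a b, |g x| ≤ exp (P * (b - a)) ^ 2 * (b - a) * (2 * ρ) := by
  set q : ℝ → ℝ := fun x => ∫ y in a..x, p y
  have hq : ∀ x, HasDerivAt q (p x) x := fun x =>
    intervalIntegral.integral_hasDerivAt_right (hp.intervalIntegrable _ _)
      (hp.stronglyMeasurableAtFilter _ _) hp.continuousAt
  have hqc : Continuous q := continuous_iff_continuousAt.2 fun x => (hq x).continuousAt
  have hP0 : 0 ≤ P := (abs_nonneg _).trans (hP a (left_mem_Icc.2 hab.le))
  have hqb : ∀ x ∈ Icc a b, |q x| ≤ P * (b - a) := fun x hx => by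
    have h1 := intervalIntegral.norm_integral_le_of_norm_le_const (a := a) (b := x) (f := p)
      (C := P) fun y hy => by
        rw [uIoc_of_le hx.1] at hy
        exact hP y ⟨hy.1.le, hy.2.trans hx.2⟩
    rw [abs_of_nonneg (sub_nonneg.2 hx.1)] at h1
    exact h1.trans (mul_le_mul_of_nonneg_left (by linarith [hx.2]) hP0)
  -- The integrating factor: (e g)' = e (r − c).
  set e : ℝ → ℝ := fun x => exp (-q x)
  have hec : Continuous e := by fun_prop
  have hrep : ∀ x ∈ Icc a b, ∫ y in a..x, e y * (r y - c) = e x * g x := fun x hx => by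
    have hder : ∀ y ∈ uIcc a x, HasDerivAt (fun y => e y * g y) (e y * (r y - c)) y :=
      fun y hy => by
        rw [uIcc_of_le hx.1] at hy
        refine ((hq y).fun_neg.exp.mul (hg y ⟨hy.1, hy.2.trans hx.2⟩)).congr_deriv ?_
        ring
    rw [intervalIntegral.integral_eq_sub_of_hasDerivAt hder
      (Continuous.intervalIntegrable (by fun_prop) _ _), hga]
    ring
  -- At x = b the representation reads ∫ e (r − c) = 0, so c is a mean of r with positive weight e,
  -- and its bound does not involve P.
  have hc : |c| ≤ ρ := by
    have h0 := hrep b (right_mem_Icc.2 hab.le)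
    rw [hgb, mul_zero] at h0
    have h1 : ∫ y in a..b, e y * (r y - c) = (∫ y in a..b, e y * r y) - c * ∫ y in a..b, e y := by
      rw [← intervalIntegral.integral_const_mul, ← intervalIntegral.integral_sub
        (Continuous.intervalIntegrable (by fun_prop) _ _)
        (Continuous.intervalIntegrable (by fun_prop) _ _)]
      congr 1
      ext y
      ring
    have hpos : 0 < ∫ y in a..b, e y :=
      intervalIntegral.intervalIntegral_pos_of_pos (hec.intervalIntegrable _ _)
        (fun y => exp_pos _) hab
    have h2 : |∫ y in a..b, e y * r y| ≤ ρ * ∫ y in a..b, e y := by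
      rw [← intervalIntegral.integral_const_mul]
      refine (intervalIntegral.abs_integral_le_integral_abs hab.le).trans ?_
      refine intervalIntegral.integral_mono_on hab.le
        (Continuous.intervalIntegrable (by fun_prop) _ _)
        (Continuous.intervalIntegrable (by fun_prop) _ _) fun y hy => ?_
      rw [abs_mul, abs_of_pos (exp_pos _), mul_comm]
      exact mul_le_mul_of_nonneg_right (hρ y hy) (exp_pos _).le
    rw [h1, sub_eq_zero] at h0
    rw [h0, abs_mul, abs_of_pos hpos] at h2
    exact le_of_mul_le_mul_right h2 hpos
  refine ⟨hc, fun x hx => ?_⟩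
  have hρ0 : 0 ≤ ρ := (abs_nonneg _).trans hc
  have h1 : |e x * g x| ≤ exp (P * (b - a)) * (2 * ρ) * (b - a) := by
    rw [← hrep x hx]
    have h2 := intervalIntegral.norm_integral_le_of_norm_le_const (a := a) (b := x)
      (f := fun y => e y * (r y - c)) (C := exp (P * (b - a)) * (2 * ρ)) fun y hy => by
        rw [uIoc_of_le hx.1] at hy
        have hy' : y ∈ Icc a b := ⟨hy.1.le, hy.2.trans hx.2⟩
        rw [norm_mul, Real.norm_eq_abs, abs_of_pos (exp_pos _)]
        refine mul_le_mul (exp_le_exp.2 ((neg_le_abs _).trans (hqb y hy'))) ?_ (norm_nonneg _)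
          (exp_pos _).le
        rw [Real.norm_eq_abs]
        linarith [abs_sub (r y) c, hρ y hy']
    refine h2.trans (mul_le_mul_of_nonneg_left ?_ (by positivity))
    rw [abs_of_nonneg (sub_nonneg.2 hx.1)]
    linarith [hx.2]
  have h3 : g x = exp (q x) * (e x * g x) := by
    rw [← mul_assoc, ← exp_add]
    simp
  rw [h3, abs_mul, abs_of_pos (exp_pos _)]
  have h4 : exp (q x) ≤ exp (P * (b - a)) := exp_le_exp.2 ((le_abs_self _).trans (hqb x hx))
  calc _ ≤ exp (P * (b - a)) * (exp (P * (b - a)) * (2 * ρ) * (b - a)) :=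
        mul_le_mul h4 h1 (abs_nonneg _) (exp_pos _).le
    _ = _ := by ring

namespace PeriodicRDA

/-! ### Trigonometric integrals -/

theorem integral_cos_int_mul_add (k : ℤ) (θ : ℝ) :
    ∫ y in (-π)..π, cos (k * y + θ) = if k = 0 then 2 * π * cos θ else 0 := by
  split_ifs with hk
  · subst hk
    simp only [Int.cast_zero, zero_mul, zero_add, intervalIntegral.integral_const, smul_eq_mul]
    ring
  · have hk' : (k : ℝ) ≠ 0 := Int.cast_ne_zero.2 hk
    have hder : ∀ y ∈ uIcc (-π) π, HasDerivAt (fun y => sin (k * y + θ) / k) (cos (k * y + θ)) y :=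
      fun y _ => by
        have h1 : HasDerivAt (fun y : ℝ => (k : ℝ) * y + θ) k y := by
          simpa using ((hasDerivAt_id y).const_mul (k : ℝ)).add_const θ
        refine (h1.sin.div_const (k : ℝ)).congr_deriv ?_
        field_simp
    rw [intervalIntegral.integral_eq_sub_of_hasDerivAt hder
      (Continuous.intervalIntegrable (by fun_prop) _ _)]
    have : (k : ℝ) * π + θ = (k * -π + θ) + k * (2 * π) := by ring
    rw [this, sin_add_int_mul_two_pi]
    ring

/-- The free phases cover sines as well (shift by π/2). The condition n ≥ 1 keeps the frequency m +
n nonzero, so only m = n contributes. -/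
theorem integral_cos_mul_cos (m n : ℕ) (hn : 1 ≤ n) (θ η : ℝ) :
    ∫ y in (-π)..π, cos (m * y + θ) * cos (n * y + η) = if m = n then π * cos (θ - η) else 0 := by
  have h : ∀ y : ℝ, cos (m * y + θ) * cos (n * y + η) =
      1 / 2 * cos (((m - n : ℤ) : ℝ) * y + (θ - η)) +
        1 / 2 * cos (((m + n : ℤ) : ℝ) * y + (θ + η)) := fun y => by
    have := two_mul_cos_mul_cos (m * y + θ) (n * y + η)
    push_cast
    rw [show ((m : ℝ) - n) * y + (θ - η) = m * y + θ - (n * y + η) by ring,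
      show ((m : ℝ) + n) * y + (θ + η) = m * y + θ + (n * y + η) by ring]
    linarith
  simp only [h]
  rw [intervalIntegral.integral_add (Continuous.intervalIntegrable (by fun_prop) _ _)
    (Continuous.intervalIntegrable (by fun_prop) _ _), intervalIntegral.integral_const_mul,
    intervalIntegral.integral_const_mul, integral_cos_int_mul_add, integral_cos_int_mul_add,
    if_neg (by omega : ¬ ((m : ℤ) + n = 0))]
  by_cases hmn : m = n
  · simp [hmn]
    ring
  · rw [if_neg (by omega), if_neg hmn]
    ring

/-! ### Pairing with continuous functions -/

theorem integral_perMeasure {F : Type*} [NormedAddCommGroup F] [NormedSpace ℝ F] (g : ℝ → F) :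
    ∫ x, g x ∂perMeasure = ∫ x in (-π)..π, g x :=
  (intervalIntegral.integral_of_le (by linarith [pi_pos])).symm

theorem memLp_of_continuous {g : ℝ → ℝ} (hg : Continuous g) : MemLp g 2 perMeasure := by
  have := memLp_mul_continuous hg (memLp_const (1 : ℝ))
  simpa using this

/-- The functional `v ↦ ∫ v g` on `L²` for continuous `g`. -/
noncomputable def pairing (g : ℝ → ℝ) (hg : Continuous g) : L2 →L[ℝ] ℝ :=
  innerSL ℝ ((memLp_of_continuous hg).toLp g)

theorem pairing_apply {g : ℝ → ℝ} (hg : Continuous g) (v : L2) :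
    pairing g hg v = ∫ x, v x * g x ∂perMeasure := by
  rw [pairing, innerSL_apply_apply, L2.inner_def]
  refine integral_congr_ae ?_
  filter_upwards [(memLp_of_continuous hg).coeFn_toLp] with x hx
  rw [hx]
  simp

theorem norm_pairing_le {g : ℝ → ℝ} (hg : Continuous g) {c : ℝ} (hc : 0 ≤ c)
    (h : ∫ x, g x ^ 2 ∂perMeasure ≤ c ^ 2) : ‖pairing g hg‖ ≤ c := by
  rw [pairing, innerSL_apply_norm]
  refine abs_le_of_sq_le_sq' ?_ hc |>.2
  rw [← real_inner_self_eq_norm_sq, L2.inner_def]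
  refine le_trans (le_of_eq (integral_congr_ae ?_)) h
  filter_upwards [(memLp_of_continuous hg).coeFn_toLp] with x hx
  rw [hx]
  simp [sq]

/-- Each test function imposes one equation between continuous functionals; closedness of the graph
gives completeness of `H1per`. -/
theorem h1Graph_isClosed : IsClosed (h1Graph : Set (WithLp 2 (L2 × L2))) := by
  have h : (h1Graph : Set (WithLp 2 (L2 × L2))) = ⋂ (φ : ℝ → ℝ) (hφ : ContDiff ℝ ∞ φ)
      (_ : Function.Periodic φ (2 * π)),
      {p | pairing (deriv φ) (hφ.continuous_deriv (by simp)) p.fst =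
        -pairing φ hφ.continuous p.snd} := by
    ext p
    simp only [mem_iInter, mem_ofPred_eq, pairing_apply]
    rfl
  rw [h]
  refine isClosed_iInter fun φ => isClosed_iInter fun hφ => isClosed_iInter fun _ => ?_
  exact isClosed_eq ((pairing _ _).continuous.comp (WithLp.fstL 2 ℝ L2 L2).continuous)
    ((pairing _ _).continuous.comp (WithLp.sndL 2 ℝ L2 L2).continuous).neg

instance : CompleteSpace H1per := h1Graph_isClosed.completeSpace_coe

/-- The function part of `u ∈ H¹_per`. -/
noncomputable def fstCLM : H1per →L[ℝ] L2 := (WithLp.fstL 2 ℝ L2 L2).comp h1Graph.subtypeL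

/-- The weak derivative as an operator on `H¹_per`. -/
noncomputable def sndCLM : H1per →L[ℝ] L2 := (WithLp.sndL 2 ℝ L2 L2).comp h1Graph.subtypeL

theorem norm_fstCLM_le (u : H1per) : ‖fstCLM u‖ ≤ ‖u‖ := WithLp.norm_fst_le L2 u.1

theorem norm_sndCLM_le (u : H1per) : ‖sndCLM u‖ ≤ ‖u‖ := WithLp.norm_snd_le L2 u.1

theorem norm_le_fstCLM_add_sndCLM (u : H1per) : ‖u‖ ≤ ‖fstCLM u‖ + ‖sndCLM u‖ := by
  have h : ‖u‖ ^ 2 = ‖fstCLM u‖ ^ 2 + ‖sndCLM u‖ ^ 2 := WithLp.prod_norm_sq_eq_of_L2 u.1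
  nlinarith [norm_nonneg u, norm_nonneg (fstCLM u), norm_nonneg (sndCLM u)]

/-! ### Fourier projections as operators into continuous functions -/

/-- Continuous functions on `[-π, π]`. -/
abbrev CI : Type := C(Icc (-π) π, ℝ)

theorem neg_pi_lt_pi : -π < π := by linarith [pi_pos]

/-- Restriction to `[-π, π]`. -/
def restrictCI (g : ℝ → ℝ) (hg : Continuous g) : CI := ⟨fun x => g x, by fun_prop⟩

/-- Cosine coefficients as functionals. -/
noncomputable def cosCLM (n : ℕ) : H1per →L[ℝ] ℝ :=
  π⁻¹ • (pairing (fun x => cos (n * x)) (by fun_prop)).comp fstCLM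

/-- Sine coefficients as functionals. -/
noncomputable def sinCLM (n : ℕ) : H1per →L[ℝ] ℝ :=
  π⁻¹ • (pairing (fun x => sin (n * x)) (by fun_prop)).comp fstCLM

theorem cosCLM_apply (n : ℕ) (u : H1per) : cosCLM n u = cosCoeff u.toFun n := by
  rw [cosCoeff, ← integral_perMeasure]
  simp only [cosCLM, _root_.smul_apply, ContinuousLinearMap.comp_apply,
    pairing_apply, smul_eq_mul]
  rfl

theorem sinCLM_apply (n : ℕ) (u : H1per) : sinCLM n u = sinCoeff u.toFun n := by
  rw [sinCoeff, ← integral_perMeasure]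
  simp only [sinCLM, _root_.smul_apply, ContinuousLinearMap.comp_apply,
    pairing_apply, smul_eq_mul]
  rfl

/-- `P_K` as an operator from `H¹_per` to continuous functions. -/
noncomputable def projCLM (K : ℕ) : H1per →L[ℝ] CI :=
  ((1 / 2 : ℝ) • cosCLM 0).smulRight (1 : CI) + ∑ n ∈ Finset.Icc 1 K,
    ((cosCLM n).smulRight (restrictCI (fun x => cos (n * x)) (by fun_prop)) +
      (sinCLM n).smulRight (restrictCI (fun x => sin (n * x)) (by fun_prop)))

theorem projCLM_apply (K : ℕ) (u : H1per) (x : Icc (-π) π) :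
    projCLM K u x = fourierProj K u x := by
  simp only [projCLM, fourierProj, _root_.add_apply, _root_.sum_apply,
    ContinuousMap.add_apply, ContinuousMap.sum_apply, ContinuousLinearMap.smulRight_apply,
    _root_.smul_apply, ContinuousMap.smul_apply, cosCLM_apply, sinCLM_apply,
    ContinuousMap.one_apply, smul_eq_mul, mul_one]
  congr 1
  ring

theorem cosCoeff_mul_cos_add_sinCoeff_mul_sin (n : ℕ) (u : H1per) (x : ℝ) :
    cosCoeff u.toFun n * cos (n * x) + sinCoeff u.toFun n * sin (n * x) =
      π⁻¹ * ∫ y, u.toFun y * cos (n * (x - y)) ∂perMeasure := by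
  have h : ∀ y, u.toFun y * cos (n * (x - y)) = u.toFun y * cos (n * y) * cos (n * x) +
      u.toFun y * sin (n * y) * sin (n * x) := fun y => by
    rw [mul_sub, cos_sub]
    ring
  simp only [h]
  rw [integral_add ((integrable_mul_continuous (by fun_prop) u.memLp_toFun).mul_const _)
    ((integrable_mul_continuous (by fun_prop) u.memLp_toFun).mul_const _), integral_mul_const,
    integral_mul_const, cosCoeff, sinCoeff, ← integral_perMeasure, ← integral_perMeasure]
  ring

/-- The weak derivative is tested against the antiderivative −sin(n(x − y))/n; the gain of 1/n makes
the Fourier tail small. -/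
theorem integral_mul_cos_eq (n : ℕ) (hn : 1 ≤ n) (u : H1per) (x : ℝ) :
    ∫ y, u.toFun y * cos (n * (x - y)) ∂perMeasure =
      ∫ y, u.weakDeriv y * (sin (n * (x - y)) / n) ∂perMeasure := by
  have hn' : (n : ℝ) ≠ 0 := by positivity
  have hd : ∀ y, HasDerivAt (fun y => -(sin (n * (x - y)) / n)) (cos (n * (x - y))) y :=
    fun y => by
      have h1 : HasDerivAt (fun y : ℝ => (n : ℝ) * (x - y)) (n * -1) y :=
        ((hasDerivAt_id y).const_sub x).const_mul (n : ℝ)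
      refine (h1.sin.div_const (n : ℝ)).fun_neg.congr_deriv ?_
      field_simp
  have h := u.isWeakDeriv (fun y => -(sin (n * (x - y)) / n)) (by fun_prop) (fun y => by
    simp only
    rw [show (n : ℝ) * (x - (y + 2 * π)) = n * (x - y) - n * (2 * π) by ring,
      sin_sub_nat_mul_two_pi])
  simp only [(hd _).deriv, mul_neg, integral_neg, neg_neg] at h
  exact h

theorem integral_sum_sin_sq (s : Finset ℕ) (hs : ∀ n ∈ s, 1 ≤ n) (x : ℝ) :
    ∫ y, (∑ n ∈ s, sin (n * (x - y)) / n) ^ 2 ∂perMeasure = π * ∑ n ∈ s, ((n : ℝ) ^ 2)⁻¹ := by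
  have h : ∀ y, (∑ n ∈ s, sin (n * (x - y)) / n) ^ 2 = ∑ m ∈ s, ∑ n ∈ s,
      ((m : ℝ) * n)⁻¹ * (cos (m * y + (π / 2 - m * x)) * cos (n * y + (π / 2 - n * x))) :=
    fun y => by
      have hc : ∀ n : ℕ, cos (n * y + (π / 2 - n * x)) = sin (n * (x - y)) := fun n => by
        rw [← cos_pi_div_two_sub]
        congr 1
        ring
      simp only [hc]
      rw [sq, Finset.sum_mul_sum]
      refine Finset.sum_congr rfl fun m _ => Finset.sum_congr rfl fun n _ => ?_
      rw [mul_inv]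
      ring
  rw [integral_perMeasure]
  simp only [h]
  rw [intervalIntegral.integral_finsetSum
    fun m _ => Continuous.intervalIntegrable (by fun_prop) _ _, Finset.mul_sum]
  refine Finset.sum_congr rfl fun m hm => ?_
  rw [intervalIntegral.integral_finsetSum
    fun m _ => Continuous.intervalIntegrable (by fun_prop) _ _]
  rw [Finset.sum_eq_single m]
  · rw [intervalIntegral.integral_const_mul, integral_cos_mul_cos m m (hs m hm), if_pos rfl,
      sub_self, cos_zero, sq]
    ring
  · intro n hn hnm
    rw [intervalIntegral.integral_const_mul, integral_cos_mul_cos m n (hs n hn),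
      if_neg (Ne.symm hnm), mul_zero]
  · exact fun h => absurd hm h

/-- At each x the tail is the pairing of u' with the kernel π⁻¹ ∑ sin(n(x − y))/n over K < n ≤ N. By
orthogonality the sum has squared L² norm π ∑ n⁻² ≤ π/K, and Cauchy–Schwarz concludes. -/
theorem norm_projCLM_sub_le {K N : ℕ} (hK : 1 ≤ K) (hKN : K ≤ N) :
    ‖projCLM N - projCLM K‖ ≤ (√K)⁻¹ := by
  refine ContinuousLinearMap.opNorm_le_bound _ (by positivity) fun u => ?_
  refine (ContinuousMap.norm_le _ (by positivity)).2 fun x => ?_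
  have hpos : ∀ n ∈ Finset.Ioc K N, 1 ≤ n := fun n hn => by
    have := (Finset.mem_Ioc.1 hn).1
    omega
  have h1 : (projCLM N - projCLM K) u x =
      ∑ n ∈ Finset.Ioc K N, (cosCoeff u.toFun n * cos (n * x) + sinCoeff u.toFun n * sin (n * x)) := by
    rw [_root_.sub_apply, ContinuousMap.sub_apply, projCLM_apply, projCLM_apply,
      fourierProj, fourierProj]
    have : Finset.Icc 1 N = Finset.Icc 1 K ∪ Finset.Ioc K N := by
      ext n
      simp only [Finset.mem_Icc, Finset.mem_union, Finset.mem_Ioc]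
      omega
    rw [this, Finset.sum_union (Finset.disjoint_left.2 fun n hn hn' => by
      simp only [Finset.mem_Icc, Finset.mem_Ioc] at hn hn'
      omega)]
    ring
  have hcont : Continuous fun y : ℝ => ∑ n ∈ Finset.Ioc K N, sin (n * (x - y)) / n := by fun_prop
  have h2 : (projCLM N - projCLM K) u x = π⁻¹ * pairing _ hcont (sndCLM u) := by
    rw [h1, pairing_apply]
    simp only [Finset.mul_sum]
    rw [integral_finsetSum _ fun n _ =>
      integrable_mul_continuous (by fun_prop) (Lp.memLp (sndCLM u)), Finset.mul_sum]
    refine Finset.sum_congr rfl fun n hn => ?_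
    rw [cosCoeff_mul_cos_add_sinCoeff_mul_sin, integral_mul_cos_eq n (hpos n hn)]
    rfl
  have hK' : (0 : ℝ) < K := by exact_mod_cast hK
  have h3 : ‖pairing _ hcont‖ ≤ √π * (√K)⁻¹ := by
    refine norm_pairing_le hcont (by positivity) ?_
    rw [integral_sum_sin_sq _ hpos, mul_pow, inv_pow, sq_sqrt pi_pos.le, sq_sqrt hK'.le]
    refine mul_le_mul_of_nonneg_left ?_ pi_pos.le
    refine (sum_Ioc_inv_sq_le_sub (by omega) hKN).trans ?_
    simp
  rw [h2, norm_mul, Real.norm_eq_abs, abs_of_pos (by positivity)]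
  have h4 : √π ≤ π := by
    rw [sqrt_le_left pi_pos.le]
    nlinarith [pi_gt_three]
  calc π⁻¹ * ‖pairing _ hcont (sndCLM u)‖ ≤ π⁻¹ * (√π * (√K)⁻¹ * ‖u‖) := by
        gcongr
        exact (ContinuousLinearMap.le_opNorm _ _).trans
          (mul_le_mul h3 (norm_sndCLM_le u) (norm_nonneg _) (by positivity))
    _ ≤ π⁻¹ * (π * (√K)⁻¹ * ‖u‖) := by gcongr
    _ = _ := by field_simp

/-! ### The embedding of `H¹_per` into continuous functions -/

/-- Constant extension of a continuous function on `[-π, π]` to the real line. -/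
noncomputable def extend (v : CI) : ℝ → ℝ := IccExtend neg_pi_lt_pi.le v

theorem continuous_extend (v : CI) : Continuous (extend v) := v.continuous.Icc_extend'

theorem extend_of_mem (v : CI) {x : ℝ} (hx : x ∈ Icc (-π) π) : extend v x = v ⟨x, hx⟩ :=
  IccExtend_of_mem _ _ hx

theorem extend_coe (v : CI) (x : Icc (-π) π) : extend v x = v x := extend_of_mem v x.2

theorem abs_extend_le (v : CI) (x : ℝ) : |extend v x| ≤ ‖v‖ := v.norm_coe_le_norm _

theorem extend_add (v w : CI) (x : ℝ) : extend (v + w) x = extend v x + extend w x := rfl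

theorem extend_smul (c : ℝ) (v : CI) (x : ℝ) : extend (c • v) x = c * extend v x := rfl

theorem ae_mem_Icc : ∀ᵐ x ∂perMeasure, x ∈ Icc (-π) π := by
  filter_upwards [ae_restrict_mem measurableSet_Ioc] with x hx using Ioc_subset_Icc_self hx

theorem integral_fourierProj_mul_cos (N m : ℕ) (hm : m ≤ N) (u : H1per) (θ : ℝ) :
    ∫ x, fourierProj N u x * cos (m * x + θ) ∂perMeasure =
      ∫ x, u.toFun x * cos (m * x + θ) ∂perMeasure := by
  have hr : ∫ x, u.toFun x * cos (m * x + θ) ∂perMeasure =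
      π * (cosCoeff u.toFun m * cos θ - sinCoeff u.toFun m * sin θ) := by
    have h : ∀ y, u.toFun y * cos (m * y + θ) = u.toFun y * cos (m * y) * cos θ -
        u.toFun y * sin (m * y) * sin θ := fun y => by
      rw [cos_add]
      ring
    simp only [h]
    rw [integral_sub ((integrable_mul_continuous (by fun_prop) u.memLp_toFun).mul_const _)
      ((integrable_mul_continuous (by fun_prop) u.memLp_toFun).mul_const _), integral_mul_const,
      integral_mul_const, cosCoeff, sinCoeff, ← integral_perMeasure, ← integral_perMeasure]
    field_simp
  have h : ∀ x, fourierProj N u x * cos (m * x + θ) =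
      cosCoeff u.toFun 0 / 2 * cos (((m : ℤ) : ℝ) * x + θ) +
      ∑ n ∈ Finset.Icc 1 N, (cosCoeff u.toFun n * (cos (m * x + θ) * cos (n * x + 0)) +
        sinCoeff u.toFun n * (cos (m * x + θ) * cos (n * x + (-(π / 2))))) := fun x => by
    rw [fourierProj, add_mul, Finset.sum_mul]
    congr 1
    refine Finset.sum_congr rfl fun n _ => ?_
    rw [← sub_eq_add_neg, cos_sub_pi_div_two, add_zero]
    ring
  rw [hr, integral_perMeasure]
  simp only [h]
  rw [intervalIntegral.integral_add (Continuous.intervalIntegrable (by fun_prop) _ _)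
    (Continuous.intervalIntegrable (by fun_prop) _ _), intervalIntegral.integral_finsetSum
    fun m _ => Continuous.intervalIntegrable (by fun_prop) _ _,
    intervalIntegral.integral_const_mul, integral_cos_int_mul_add]
  have hsum : ∀ n ∈ Finset.Icc 1 N,
      ∫ x in (-π)..π, (cosCoeff u.toFun n * (cos (m * x + θ) * cos (n * x + 0)) +
        sinCoeff u.toFun n * (cos (m * x + θ) * cos (n * x + (-(π / 2))))) =
      if m = n then π * (cosCoeff u.toFun m * cos θ - sinCoeff u.toFun m * sin θ) else 0 :=
    fun n hn => by
      have hn1 : 1 ≤ n := (Finset.mem_Icc.1 hn).1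
      rw [intervalIntegral.integral_add (Continuous.intervalIntegrable (by fun_prop) _ _)
        (Continuous.intervalIntegrable (by fun_prop) _ _), intervalIntegral.integral_const_mul,
        intervalIntegral.integral_const_mul, integral_cos_mul_cos m n hn1,
        integral_cos_mul_cos m n hn1]
      split_ifs with hmn
      · subst hmn
        rw [sub_zero, sub_neg_eq_add, cos_add_pi_div_two]
        ring
      · ring
  rw [Finset.sum_congr rfl hsum, Finset.sum_ite_eq]
  rcases Nat.eq_zero_or_pos m with rfl | hm0
  · have : sinCoeff u.toFun 0 = 0 := by simp [sinCoeff]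
    simp [this]
    ring
  · rw [if_neg (by omega), if_pos (Finset.mem_Icc.2 ⟨hm0, hm⟩)]
    ring

/-- A real square integrable function with vanishing Fourier coefficients vanishes. -/
theorem ae_eq_zero_of_integral_mul_cos {d : ℝ → ℝ} (hd : MemLp d 2 perMeasure)
    (h : ∀ (m : ℕ) (θ : ℝ), ∫ x, d x * cos (m * x + θ) ∂perMeasure = 0) :
    d =ᵐ[perMeasure] 0 := by
  have hz : ∀ (k : ℤ) (θ : ℝ), ∫ x, d x * cos (k * x + θ) ∂perMeasure = 0 := fun k θ => by
    obtain ⟨m, rfl | rfl⟩ := Int.eq_nat_or_neg k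
    · exact h m θ
    · rw [← h m (-θ)]
      congr 1
      ext x
      rw [← cos_neg]
      push_cast
      ring_nf
  have hdc : MemLp (fun x => (d x : ℂ)) 2 perMeasure := hd.ofReal
  -- The integrand of a complex coefficient has real and imaginary parts d cos(kx) and d cos(kx +
  -- π/2). Once all coefficients vanish, Parseval gives ∫ |d|² = 0.
  have hc : ∀ k : ℤ, fourierCoeffOn neg_pi_lt_pi (fun x => (d x : ℂ)) k = 0 := fun k => by
    rw [fourierCoeffOn_eq_integral, ← integral_perMeasure]
    have he : ∀ x : ℝ, (fourier (-k) (x : AddCircle (π - -π)) : ℂ) • (d x : ℂ) =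
        ((d x * cos (k * x + 0) : ℝ) : ℂ) + Complex.I * ((d x * cos (k * x + π / 2) : ℝ) : ℂ) :=
      fun x => by
        have : (2 * π * Complex.I * ((-k : ℤ) : ℂ) * x / ((π - -π : ℝ) : ℂ) : ℂ) =
            ((-(k * x) : ℝ) : ℂ) * Complex.I := by
          have : (π : ℂ) ≠ 0 := Complex.ofReal_ne_zero.2 pi_pos.ne'
          push_cast
          rw [show (π : ℂ) - -π = 2 * π by ring]
          field_simp
        rw [fourier_coe_apply, this, Complex.exp_mul_I, ← Complex.ofReal_cos,
          ← Complex.ofReal_sin, cos_neg, sin_neg, cos_add_pi_div_two, add_zero]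
        push_cast
        simp only [smul_eq_mul]
        ring
    simp only [he]
    rw [integral_add (integrable_mul_continuous (by fun_prop) hd).ofReal
      ((integrable_mul_continuous (by fun_prop) hd).ofReal.const_mul _), integral_const_mul,
      integral_complex_ofReal, integral_complex_ofReal, hz, hz]
    simp
  have hs := hasSum_sq_fourierCoeffOn neg_pi_lt_pi hdc
  simp only [hc, norm_zero, ne_eq, OfNat.ofNat_ne_zero, not_false_eq_true, zero_pow] at hs
  have h0 := hs.unique hasSum_zero
  rw [← integral_perMeasure, smul_eq_mul, mul_eq_zero] at h0
  have h1 : ∫ x, ‖(d x : ℂ)‖ ^ 2 ∂perMeasure = 0 := h0.resolve_left (by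
    rw [inv_eq_zero, sub_neg_eq_add]
    positivity)
  rw [integral_eq_zero_iff_of_nonneg (fun x => by positivity) (hdc.integrable_norm_pow (by simp))]
    at h1
  filter_upwards [h1] with x hx
  simpa using hx

/-- The operators P_K are Cauchy in norm from H¹ to C[-π, π], and J is their limit. It represents u
because P_N u and u have the same coefficients up to N, so those of J u − u are O(N^{-1/2}) for
every large N. -/
theorem exists_embedding : ∃ J : H1per →L[ℝ] CI, (∀ K : ℕ, 1 ≤ K → ‖J - projCLM K‖ ≤ (√K)⁻¹) ∧
    ∀ u, extend (J u) =ᵐ[perMeasure] u.toFun := by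
  have hlim : Filter.Tendsto (fun K : ℕ => (√K)⁻¹) Filter.atTop (nhds 0) :=
    (tendsto_sqrt_atTop.comp tendsto_natCast_atTop_atTop).inv_tendsto_atTop
  have hcau : CauchySeq projCLM := by
    refine (Metric.cauchySeq_iff' (u := projCLM)).2 fun ε hε => ?_
    obtain ⟨K, hK, hK1⟩ := ((hlim.eventually (gt_mem_nhds hε)).and
      (Filter.eventually_ge_atTop 1)).exists
    exact ⟨K, fun N hN => (dist_eq_norm (projCLM N) (projCLM K)).trans_lt ((norm_projCLM_sub_le hK1 hN).trans_lt hK)⟩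
  obtain ⟨J, hJ⟩ := cauchySeq_tendsto_of_complete hcau
  have hJK : ∀ K : ℕ, 1 ≤ K → ‖J - projCLM K‖ ≤ (√K)⁻¹ := fun K hK => by
    rw [← dist_eq_norm J (projCLM K)]
    refine le_of_tendsto (hJ.dist (tendsto_const_nhds (x := projCLM K)))
      ((Filter.eventually_ge_atTop K).mono fun N hN => ?_)
    rw [dist_eq_norm (projCLM N) (projCLM K)]
    exact norm_projCLM_sub_le hK hN
  refine ⟨J, hJK, fun u => ?_⟩
  have hJm : MemLp (extend (J u)) 2 perMeasure := memLp_of_continuous (continuous_extend _)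
  have hzero := ae_eq_zero_of_integral_mul_cos (hJm.sub u.memLp_toFun) fun m θ => by
    have hval : ∀ N : ℕ, m ≤ N → 1 ≤ N →
        |∫ x, (extend (J u) - u.toFun) x * cos (m * x + θ) ∂perMeasure| ≤
          (√N)⁻¹ * (‖u‖ * (2 * π)) := fun N hN hN1 => by
      have e1 : ∫ x, (extend (J u) - u.toFun) x * cos (m * x + θ) ∂perMeasure =
          ∫ x, (extend (J u) x - fourierProj N u x) * cos (m * x + θ) ∂perMeasure := by
        simp only [Pi.sub_apply, sub_mul]
        rw [integral_sub (integrable_mul_continuous (by fun_prop) hJm)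
          (integrable_mul_continuous (by fun_prop) u.memLp_toFun),
          integral_sub (integrable_mul_continuous (by fun_prop) hJm)
          (integrable_mul_continuous (by fun_prop)
            (memLp_of_continuous (contDiff_fourierProj N u).continuous)),
          integral_fourierProj_mul_cos N m hN]
      have hb : ∀ x ∈ uIoc (-π) π,
          ‖(extend (J u) x - fourierProj N u x) * cos (m * x + θ)‖ ≤ (√N)⁻¹ * ‖u‖ := fun x hx => by
        rw [uIoc_of_le neg_pi_lt_pi.le] at hx
        have hx' := Ioc_subset_Icc_self hx
        rw [extend_of_mem _ hx', norm_mul]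
        have h1 : ‖J u ⟨x, hx'⟩ - fourierProj N u x‖ ≤ (√N)⁻¹ * ‖u‖ := by
          have h2 := ((J - projCLM N) u).norm_coe_le_norm ⟨x, hx'⟩
          rw [_root_.sub_apply, ContinuousMap.sub_apply, projCLM_apply] at h2
          exact h2.trans (((J - projCLM N).le_opNorm u).trans
            (mul_le_mul_of_nonneg_right (hJK N hN1) (norm_nonneg _)))
        calc _ ≤ (√N)⁻¹ * ‖u‖ * 1 := mul_le_mul h1 (abs_cos_le_one _) (abs_nonneg _) (by positivity)
          _ = _ := mul_one _
      rw [e1, integral_perMeasure]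
      refine (intervalIntegral.norm_integral_le_of_norm_le_const hb).trans (le_of_eq ?_)
      rw [sub_neg_eq_add, abs_of_pos (by positivity)]
      ring
    have h0 := hlim.mul_const (‖u‖ * (2 * π))
    rw [zero_mul] at h0
    refine abs_eq_zero.1 (le_antisymm (ge_of_tendsto h0 ?_) (abs_nonneg _))
    filter_upwards [Filter.eventually_ge_atTop m, Filter.eventually_ge_atTop 1] with N h1 h2
    exact hval N h1 h2
  filter_upwards [hzero] with x hx
  exact sub_eq_zero.1 hx

/-- The embedding `H¹_per → C[-π, π]`. -/
noncomputable def embed : H1per →L[ℝ] CI := exists_embedding.choose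

theorem norm_embed_sub_projCLM_le {K : ℕ} (hK : 1 ≤ K) : ‖embed - projCLM K‖ ≤ (√K)⁻¹ :=
  exists_embedding.choose_spec.1 K hK

theorem extend_embed (u : H1per) : extend (embed u) =ᵐ[perMeasure] u.toFun :=
  exists_embedding.choose_spec.2 u

theorem norm_projCLM_le {K : ℕ} (hK : 1 ≤ K) : ‖projCLM K‖ ≤ ‖embed‖ + 1 := by
  have h1 : (√K)⁻¹ ≤ 1 := inv_le_one_of_one_le₀ (by
    rw [one_le_sqrt]
    exact_mod_cast hK)
  have h2 := (norm_sub_norm_le (projCLM K) embed).trans_eq (norm_sub_rev (projCLM K) embed)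
  linarith [norm_embed_sub_projCLM_le hK]

theorem eq_of_extend_ae_eq {v w : CI} (h : extend v =ᵐ[perMeasure] extend w) : v = w := by
  have h1 : extend v =ᵐ[volume.restrict (Icc (-π) π)] extend w := by
    rwa [← restrict_Ioc_eq_restrict_Icc]
  have h2 := Measure.eqOn_Icc_of_ae_eq volume neg_pi_lt_pi.ne h1
    (continuous_extend v).continuousOn (continuous_extend w).continuousOn
  ext x
  rw [← extend_coe, ← extend_coe]
  exact h2 x.2

/-! ### Multiplication operators -/

theorem norm_toLp_extend_mul_le (v : CI) (w : L2) :
    ‖(memLp_mul_continuous (continuous_extend v) (Lp.memLp w)).toLp _‖ ≤ ‖v‖ * ‖w‖ := by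
  refine Lp.norm_le_mul_norm_of_ae_le_mul ?_
  filter_upwards [(memLp_mul_continuous (continuous_extend v) (Lp.memLp w)).coeFn_toLp] with x hx
  rw [hx, norm_mul]
  exact mul_le_mul_of_nonneg_right (abs_extend_le v x) (norm_nonneg _)

/-- Multiplication of square integrable functions by continuous functions. -/
noncomputable def mulL2 : CI →L[ℝ] L2 →L[ℝ] L2 :=
  LinearMap.mkContinuous₂
    (LinearMap.mk₂ ℝ
      (fun v w => (memLp_mul_continuous (continuous_extend v) (Lp.memLp w)).toLp _)
      (fun v v' w => by
        rw [← MemLp.toLp_add]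
        refine MemLp.toLp_congr _ _ (Filter.Eventually.of_forall fun x => ?_)
        simp only [Pi.add_apply, extend_add]
        ring)
      (fun c v w => by
        rw [← MemLp.toLp_const_smul]
        refine MemLp.toLp_congr _ _ (Filter.Eventually.of_forall fun x => ?_)
        simp only [Pi.smul_apply, smul_eq_mul, extend_smul]
        ring)
      (fun v w w' => by
        rw [← MemLp.toLp_add]
        refine MemLp.toLp_congr _ _ ?_
        filter_upwards [Lp.coeFn_add w w'] with x hx
        simp only [hx, Pi.add_apply]
        ring)
      (fun c v w => by
        rw [← MemLp.toLp_const_smul]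
        refine MemLp.toLp_congr _ _ ?_
        filter_upwards [Lp.coeFn_smul c w] with x hx
        simp only [hx, Pi.smul_apply, smul_eq_mul]
        ring)) 1 (fun v w => by
      rw [one_mul]
      exact norm_toLp_extend_mul_le v w)

theorem mulL2_coeFn (v : CI) (w : L2) : mulL2 v w =ᵐ[perMeasure] fun x => extend v x * w x :=
  (memLp_mul_continuous (continuous_extend v) (Lp.memLp w)).coeFn_toLp

theorem norm_mulL2_le (v : CI) (w : L2) : ‖mulL2 v w‖ ≤ ‖v‖ * ‖w‖ := norm_toLp_extend_mul_le v w

theorem mulL2_mul (v v' : CI) (w : L2) : mulL2 (v * v') w = mulL2 v (mulL2 v' w) := by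
  refine Lp.ext ?_
  filter_upwards [mulL2_coeFn (v * v') w, mulL2_coeFn v (mulL2 v' w), mulL2_coeFn v' w]
    with x h1 h2 h3
  rw [h1, h2, h3, ← mul_assoc]
  rfl

theorem mulL2_one (w : L2) : mulL2 1 w = w := by
  refine Lp.ext ?_
  filter_upwards [mulL2_coeFn 1 w] with x h1
  rw [h1, show extend 1 x = 1 from rfl, one_mul]

theorem h1_ext {u v : H1per} (h0 : fstCLM u = fstCLM v) (h1 : sndCLM u = sndCLM v) : u = v := by
  have : ‖u - v‖ ≤ 0 := by
    simpa [h0, h1] using norm_le_fstCLM_add_sndCLM (u - v)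
  exact sub_eq_zero.1 (norm_le_zero_iff.1 this)

section MulSmooth

variable {g : ℝ → ℝ} (hg : ContDiff ℝ ∞ g) (hper : Function.Periodic g (2 * π))

theorem fstCLM_mulSmooth {a : CI} (ha : ∀ x : Icc (-π) π, a x = g x) (u : H1per) :
    fstCLM (mulSmooth g hg hper u) = mulL2 a (fstCLM u) := by
  refine Lp.ext ?_
  filter_upwards [mulSmooth_toFun g hg hper u, mulL2_coeFn a (fstCLM u), ae_mem_Icc] with x h1 h2 hx
  rw [h2, extend_of_mem a hx, ha]
  exact h1

theorem sndCLM_mulSmooth {a b : CI} (ha : ∀ x : Icc (-π) π, a x = g x)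
    (hb : ∀ x : Icc (-π) π, b x = deriv g x) (u : H1per) :
    sndCLM (mulSmooth g hg hper u) = mulL2 a (sndCLM u) + mulL2 b (fstCLM u) := by
  refine Lp.ext ?_
  filter_upwards [(memLp_mulSmooth_deriv hg u).coeFn_toLp,
    Lp.coeFn_add (mulL2 a (sndCLM u)) (mulL2 b (fstCLM u)), mulL2_coeFn a (sndCLM u),
    mulL2_coeFn b (fstCLM u), ae_mem_Icc] with x h1 h2 h3 h4 hx
  rw [h2, Pi.add_apply, h3, h4, extend_of_mem a hx, extend_of_mem b hx, ha, hb, add_comm]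
  exact h1

/-- Multiplication by a smooth periodic function as a linear map. -/
noncomputable def mulSmoothLM : H1per →ₗ[ℝ] H1per where
  toFun := mulSmooth g hg hper
  map_add' u v := by
    refine h1_ext ?_ ?_
    · simp only [map_add,
        fstCLM_mulSmooth hg hper (a := restrictCI g hg.continuous) (fun _ => rfl)]
    · simp only [map_add, sndCLM_mulSmooth hg hper (a := restrictCI g hg.continuous)
        (b := restrictCI (deriv g) (hg.continuous_deriv (by simp))) (fun _ => rfl) (fun _ => rfl)]
      abel
  map_smul' c u := by
    refine h1_ext ?_ ?_
    · simp only [map_smul, RingHom.id_apply,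
        fstCLM_mulSmooth hg hper (a := restrictCI g hg.continuous) (fun _ => rfl)]
    · simp only [map_smul, RingHom.id_apply,
        sndCLM_mulSmooth hg hper (a := restrictCI g hg.continuous)
        (b := restrictCI (deriv g) (hg.continuous_deriv (by simp))) (fun _ => rfl) (fun _ => rfl),
        smul_add]

theorem mulSmooth_mulSmooth_of_mul_eq_one {k : ℝ → ℝ} (hk : ContDiff ℝ ∞ k)
    (hkper : Function.Periodic k (2 * π)) (hgk : ∀ x, g x * k x = 1) (u : H1per) :
    mulSmooth g hg hper (mulSmooth k hk hkper u) = u := by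
  set a := restrictCI g hg.continuous with ha
  set b := restrictCI (deriv g) (hg.continuous_deriv (by simp)) with hb
  set a' := restrictCI k hk.continuous with ha'
  set b' := restrictCI (deriv k) (hk.continuous_deriv (by simp)) with hb'
  have h1 : a * a' = 1 := by
    ext x
    exact hgk x
  -- This is (gk)' = 0; it cancels the zeroth-order terms in the derivative component.
  have h2 : a * b' + b * a' = 0 := by
    ext x
    have hd : deriv (fun y => g y * k y) x = 0 := by
      rw [funext hgk]
      simp
    rw [deriv_fun_mul (hg.differentiable (by simp) x) (hk.differentiable (by simp) x)] at hd
    exact (add_comm (g x * deriv k x) (deriv g x * k x)).trans hd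
  refine h1_ext ?_ ?_
  · rw [fstCLM_mulSmooth hg hper (a := a) (fun _ => rfl),
      fstCLM_mulSmooth hk hkper (a := a') (fun _ => rfl), ← mulL2_mul, h1, mulL2_one]
  · rw [sndCLM_mulSmooth hg hper (a := a) (b := b) (fun _ => rfl) (fun _ => rfl),
      sndCLM_mulSmooth hk hkper (a := a') (b := b') (fun _ => rfl) (fun _ => rfl),
      fstCLM_mulSmooth hk hkper (a := a') (fun _ => rfl), map_add, ← mulL2_mul, ← mulL2_mul,
      ← mulL2_mul, h1, mulL2_one, add_assoc, ← _root_.add_apply, ← map_add, h2]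
    simp

theorem bijective_mulSmoothLM (h0 : ∀ x, g x ≠ 0) : Function.Bijective (mulSmoothLM hg hper) := by
  have hk : ContDiff ℝ ∞ fun x => (g x)⁻¹ := hg.inv h0
  have hkper : Function.Periodic (fun x => (g x)⁻¹) (2 * π) := fun x => by simp only [hper x]
  refine Function.bijective_iff_has_inverse.2 ⟨mulSmooth _ hk hkper, fun u => ?_, fun u => ?_⟩
  · exact mulSmooth_mulSmooth_of_mul_eq_one hk hkper hg hper (fun x => inv_mul_cancel₀ (h0 x)) u
  · exact mulSmooth_mulSmooth_of_mul_eq_one hg hper hk hkper (fun x => mul_inv_cancel₀ (h0 x)) u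

end MulSmooth

/-! ### The exponent of the factor as a function on `[-π, π]` -/

/-- Integration over `[-π, π]` as a functional. -/
noncomputable def integralCLM : CI →L[ℝ] ℝ :=
  LinearMap.mkContinuous
    { toFun := fun v => ∫ x in (-π)..π, extend v x
      map_add' := fun v w => intervalIntegral.integral_add
        ((continuous_extend v).intervalIntegrable _ _)
        ((continuous_extend w).intervalIntegrable _ _)
      map_smul' := fun c v => intervalIntegral.integral_const_mul c _ } (2 * π) fun v => by
    refine (intervalIntegral.norm_integral_le_of_norm_le_const
      fun x _ => abs_extend_le v x).trans (le_of_eq ?_)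
    rw [sub_neg_eq_add, abs_of_pos (by positivity)]
    ring

theorem integralCLM_apply (v : CI) : integralCLM v = ∫ x in (-π)..π, extend v x := rfl

/-- `φ ↦ ½ (φ - ⟨φ⟩)`. -/
noncomputable def centerCLM : CI →L[ℝ] CI :=
  (1 / 2 : ℝ) • (ContinuousLinearMap.id ℝ CI - ((2 * π)⁻¹ • integralCLM).smulRight (1 : CI))

theorem centerCLM_apply (v : CI) (x : Icc (-π) π) :
    centerCLM v x = 1 / 2 * (v x - (2 * π)⁻¹ * integralCLM v) := by
  change 1 / 2 * (v x - (2 * π)⁻¹ * integralCLM v * 1) = _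
  rw [mul_one]

theorem norm_centerCLM_le (v : CI) : ‖centerCLM v‖ ≤ ‖v‖ := by
  refine (ContinuousMap.norm_le _ (norm_nonneg _)).2 fun x => ?_
  have h1 : |integralCLM v| ≤ 2 * π * ‖v‖ := by
    refine (intervalIntegral.norm_integral_le_of_norm_le_const (f := extend v)
      fun x _ => abs_extend_le v x).trans (le_of_eq ?_)
    rw [sub_neg_eq_add, abs_of_pos (by positivity)]
    ring
  have h2 : |(2 * π)⁻¹ * integralCLM v| ≤ ‖v‖ := by
    rw [abs_mul, abs_of_pos (by positivity : 0 < (2 * π)⁻¹), inv_mul_le_iff₀ (by positivity)]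
    exact h1
  have h3 : |v x| ≤ ‖v‖ := v.norm_coe_le_norm x
  rw [centerCLM_apply, Real.norm_eq_abs, abs_le]
  rw [abs_le] at h2 h3
  constructor <;> linarith

theorem integral_extend_centerCLM (v : CI) : ∫ x in (-π)..π, extend (centerCLM v) x = 0 := by
  have h : ∀ x, extend (centerCLM v) x = 1 / 2 * (extend v x - (2 * π)⁻¹ * integralCLM v) :=
    fun x => centerCLM_apply v _
  simp only [h]
  rw [intervalIntegral.integral_const_mul, intervalIntegral.integral_sub
    ((continuous_extend v).intervalIntegrable _ _) (continuous_const.intervalIntegrable _ _),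
    intervalIntegral.integral_const, ← integralCLM_apply, smul_eq_mul]
  have := pi_pos.ne'
  field_simp
  ring

/-- The primitive vanishing at `-π`. -/
noncomputable def primitiveCLM : CI →L[ℝ] CI :=
  LinearMap.mkContinuous
    { toFun := fun v => restrictCI (fun x => ∫ y in (-π)..x, extend v y)
        (intervalIntegral.continuous_primitive
          (fun a b => (continuous_extend v).intervalIntegrable a b) _)
      map_add' := fun v w => by
        ext x
        exact intervalIntegral.integral_add
          ((continuous_extend v).intervalIntegrable _ _)
          ((continuous_extend w).intervalIntegrable _ _)
      map_smul' := fun c v => by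
        ext x
        exact intervalIntegral.integral_const_mul c _ } (2 * π) fun v => by
    refine (ContinuousMap.norm_le _ (by positivity)).2 fun x => ?_
    refine (intervalIntegral.norm_integral_le_of_norm_le_const
      fun x _ => abs_extend_le v x).trans ?_
    rw [mul_comm (2 * π), abs_of_nonneg (by linarith [x.2.1])]
    exact mul_le_mul_of_nonneg_left (by linarith [x.2.2]) (norm_nonneg _)

theorem primitiveCLM_apply (v : CI) (x : Icc (-π) π) :
    primitiveCLM v x = ∫ y in (-π)..x, extend v y := rfl

theorem norm_primitiveCLM_le (v : CI) : ‖primitiveCLM v‖ ≤ 2 * π * ‖v‖ :=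
  (primitiveCLM.le_opNorm v).trans (mul_le_mul_of_nonneg_right
    (LinearMap.mkContinuous_norm_le _ (by positivity) _) (norm_nonneg _))

section Exponent

variable {f : ℝ → ℝ} (hf : Continuous f)

/-- The coefficient `½ [f(P_K u) - ⟨f(P_K u)⟩]` on `[-π, π]`. -/
noncomputable def rate (K : ℕ) (u : H1per) : CI := centerCLM (superposition f hf (projCLM K u))

/-- The exponent of the factor on `[-π, π]`. -/
noncomputable def exponent (K : ℕ) (u : H1per) : CI := primitiveCLM (rate hf K u)

theorem rate_apply (K : ℕ) (u : H1per) (x : Icc (-π) π) : rate hf K u x =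
    1 / 2 * (f (fourierProj K u x) - mean (fun y => f (fourierProj K u y))) := by
  rw [rate, centerCLM_apply, mean, integralCLM_apply]
  have h : ∫ y in (-π)..π, extend (superposition f hf (projCLM K u)) y =
      ∫ y in (-π)..π, f (fourierProj K u y) := by
    refine intervalIntegral.integral_congr fun y hy => ?_
    rw [uIcc_of_le neg_pi_lt_pi.le] at hy
    simp only [extend_of_mem _ hy]
    exact congrArg f (projCLM_apply K u ⟨y, hy⟩)
  rw [h]
  congr 2
  exact congrArg f (projCLM_apply K u x)

theorem exponent_apply (K : ℕ) (u : H1per) (x : Icc (-π) π) :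
    exponent hf K u x = factorExponent f K u x := by
  rw [exponent, primitiveCLM_apply, factorExponent]
  refine intervalIntegral.integral_congr fun y hy => ?_
  rw [uIcc_of_le x.2.1] at hy
  have hy' : y ∈ Icc (-π) π := ⟨hy.1, hy.2.trans x.2.2⟩
  simp only [extend_of_mem _ hy']
  exact rate_apply hf K u ⟨y, hy'⟩

theorem norm_rate_le {F : ℝ} (hF0 : 0 ≤ F) (hF : ∀ x, |f x| ≤ F) (K : ℕ) (u : H1per) :
    ‖rate hf K u‖ ≤ F :=
  (norm_centerCLM_le _).trans (norm_superposition_le hf hF0 hF _)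

theorem norm_exponent_le {F : ℝ} (hF0 : 0 ≤ F) (hF : ∀ x, |f x| ≤ F) (K : ℕ) (u : H1per) :
    ‖exponent hf K u‖ ≤ 2 * π * F :=
  (norm_primitiveCLM_le _).trans
    (mul_le_mul_of_nonneg_left (norm_rate_le hf hF0 hF K u) (by positivity))

end Exponent

/-! ### The transform in terms of bounded operators -/

section Transform

variable {f : ℝ → ℝ} (hf : ContDiff ℝ ∞ f)

/-- The exponential of a continuous function. -/
noncomputable def expCI (v : CI) : CI := superposition exp continuous_exp v

theorem expCI_mul_expCI_neg (v : CI) : expCI v * expCI (-v) = 1 := by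
  ext x
  change exp (v x) * exp (-v x) = 1
  rw [← exp_add, add_neg_cancel, exp_zero]

theorem norm_expCI_le {v : CI} {B : ℝ} (h : ‖v‖ ≤ B) : ‖expCI v‖ ≤ exp B := by
  refine (ContinuousMap.norm_le _ (exp_pos B).le).2 fun x => ?_
  change ‖exp (v x)‖ ≤ exp B
  rw [Real.norm_eq_abs, abs_of_pos (exp_pos _), exp_le_exp]
  exact (le_abs_self _).trans ((v.norm_coe_le_norm x).trans h)

theorem expCI_neg_exponent_apply (K : ℕ) (u : H1per) (x : Icc (-π) π) :
    expCI (-exponent hf.continuous K u) x = (factor f hf K u x)⁻¹ := by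
  rw [factor_eq_exp, ← exp_neg, ← exponent_apply hf.continuous]
  rfl

theorem fstCLM_transform (K : ℕ) (u : H1per) : fstCLM (transform f hf K u) =
    mulL2 (expCI (-exponent hf.continuous K u)) (fstCLM u) :=
  fstCLM_mulSmooth _ _ (expCI_neg_exponent_apply hf K u) u

theorem sndCLM_transform (K : ℕ) (u : H1per) : sndCLM (transform f hf K u) =
    mulL2 (expCI (-exponent hf.continuous K u)) (sndCLM u) +
      mulL2 (-(expCI (-exponent hf.continuous K u) * rate hf.continuous K u)) (fstCLM u) := by
  refine sndCLM_mulSmooth _ _ (expCI_neg_exponent_apply hf K u) (fun x => ?_) u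
  have hd : HasDerivAt (fun x => (factor f hf K u x)⁻¹)
      (-((factor f hf K u x)⁻¹ * rate hf.continuous K u x)) x := by
    rw [factor_eq_exp, rate_apply]
    simp only [← exp_neg]
    refine (hasDerivAt_factorExponent hf K u x).fun_neg.exp.congr_deriv ?_
    ring
  rw [hd.deriv, ← expCI_neg_exponent_apply hf K u x]
  rfl

theorem fstCLM_eq_transform (K : ℕ) (u : H1per) : fstCLM u =
    mulL2 (expCI (exponent hf.continuous K u)) (fstCLM (transform f hf K u)) := by
  rw [fstCLM_transform, ← mulL2_mul, expCI_mul_expCI_neg, mulL2_one]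

theorem sndCLM_eq_transform (K : ℕ) (u : H1per) : sndCLM u =
    mulL2 (expCI (exponent hf.continuous K u)) (sndCLM (transform f hf K u)) +
      mulL2 (expCI (exponent hf.continuous K u) * rate hf.continuous K u)
        (fstCLM (transform f hf K u)) := by
  rw [fstCLM_transform, sndCLM_transform, map_add, ← mulL2_mul, ← mulL2_mul, ← mulL2_mul,
    expCI_mul_expCI_neg, mulL2_one, add_assoc, ← _root_.add_apply, ← map_add]
  have : expCI (exponent hf.continuous K u) *
      -(expCI (-exponent hf.continuous K u) * rate hf.continuous K u) +
      expCI (exponent hf.continuous K u) * rate hf.continuous K u *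
        expCI (-exponent hf.continuous K u) = 0 := by ring
  rw [this]
  simp

/-- The relation u = e^{g}w holds at every point, not only almost everywhere, so it may be inserted
into the differential equation for g. -/
theorem embed_eq_transform (K : ℕ) (u : H1per) :
    embed u = expCI (exponent hf.continuous K u) * embed (transform f hf K u) := by
  refine eq_of_extend_ae_eq ?_
  have h := fstCLM_eq_transform hf K u
  filter_upwards [extend_embed u, extend_embed (transform f hf K u),
    mulL2_coeFn (expCI (exponent hf.continuous K u)) (fstCLM (transform f hf K u))] with x h1 h2 h3
  rw [← h] at h3
  rw [h1]
  refine h3.trans ?_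
  change _ = extend (expCI (exponent hf.continuous K u)) x * extend (embed (transform f hf K u)) x
  rw [h2]
  rfl

theorem transform_zero (K : ℕ) : transform f hf K 0 = 0 := by
  refine h1_ext ?_ ?_
  · rw [fstCLM_transform]
    simp
  · rw [sndCLM_transform]
    simp

/-- Shared by both directions of the norm comparison: multiplication by e^{±g} costs α = e^{2πF},
and differentiating that factor costs a further β = F. -/
theorem norm_le_of_fst_snd {u w : H1per} {a b : CI} {α β : ℝ} (ha : ‖a‖ ≤ α) (hb : ‖b‖ ≤ α * β)
    (h0 : fstCLM u = mulL2 a (fstCLM w))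
    (h1 : sndCLM u = mulL2 a (sndCLM w) + mulL2 b (fstCLM w)) :
    ‖u‖ ≤ α * (2 + β) * ‖w‖ := by
  have e0 : ‖fstCLM u‖ ≤ α * ‖w‖ := by
    rw [h0]
    exact (norm_mulL2_le _ _).trans (mul_le_mul ha (norm_fstCLM_le w) (norm_nonneg _)
      ((norm_nonneg _).trans ha))
  have e1 : ‖sndCLM u‖ ≤ α * ‖w‖ + α * β * ‖w‖ := by
    rw [h1]
    refine (norm_add_le _ _).trans (add_le_add ?_ ?_)
    · exact (norm_mulL2_le _ _).trans (mul_le_mul ha (norm_sndCLM_le w) (norm_nonneg _)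
        ((norm_nonneg _).trans ha))
    · exact (norm_mulL2_le _ _).trans (mul_le_mul hb (norm_fstCLM_le w) (norm_nonneg _)
        ((norm_nonneg _).trans hb))
  calc ‖u‖ ≤ α * ‖w‖ + (α * ‖w‖ + α * β * ‖w‖) :=
        (norm_le_fstCLM_add_sndCLM u).trans (add_le_add e0 e1)
    _ = _ := by ring

theorem norm_transform_le {F : ℝ} (hF0 : 0 ≤ F) (hF : ∀ x, |f x| ≤ F) (K : ℕ) (u : H1per) :
    ‖transform f hf K u‖ ≤ exp (2 * π * F) * (2 + F) * ‖u‖ := by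
  have hA : ‖expCI (-exponent hf.continuous K u)‖ ≤ exp (2 * π * F) := norm_expCI_le (by
    rw [norm_neg]
    exact norm_exponent_le hf.continuous hF0 hF K u)
  refine norm_le_of_fst_snd hA ?_ (fstCLM_transform hf K u) (sndCLM_transform hf K u)
  rw [norm_neg]
  exact (norm_mul_le _ _).trans (mul_le_mul hA (norm_rate_le hf.continuous hF0 hF K u)
    (norm_nonneg _) (exp_pos _).le)

theorem norm_le_transform {F : ℝ} (hF0 : 0 ≤ F) (hF : ∀ x, |f x| ≤ F) (K : ℕ) (u : H1per) :
    ‖u‖ ≤ exp (2 * π * F) * (2 + F) * ‖transform f hf K u‖ := by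
  have hA : ‖expCI (exponent hf.continuous K u)‖ ≤ exp (2 * π * F) :=
    norm_expCI_le (norm_exponent_le hf.continuous hF0 hF K u)
  refine norm_le_of_fst_snd hA ?_ (fstCLM_eq_transform hf K u) (sndCLM_eq_transform hf K u)
  exact (norm_mul_le _ _).trans (mul_le_mul hA (norm_rate_le hf.continuous hF0 hF K u)
    (norm_nonneg _) (exp_pos _).le)

end Transform

/-! ### Uniform smoothness of the transform -/

/-- The inclusion of the first component of `L² × L²`. -/
noncomputable def inlCLM : L2 →L[ℝ] WithLp 2 (L2 × L2) :=
  ((WithLp.prodContinuousLinearEquiv 2 ℝ L2 L2).symm : (L2 × L2) →L[ℝ] WithLp 2 (L2 × L2)).comp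
    (ContinuousLinearMap.inl ℝ L2 L2)

/-- The inclusion of the second component of `L² × L²`. -/
noncomputable def inrCLM : L2 →L[ℝ] WithLp 2 (L2 × L2) :=
  ((WithLp.prodContinuousLinearEquiv 2 ℝ L2 L2).symm : (L2 × L2) →L[ℝ] WithLp 2 (L2 × L2)).comp
    (ContinuousLinearMap.inr ℝ L2 L2)

/-- Reassembles u from its two L² components by bounded linear maps, so smoothness of an H¹-valued
map can be checked on L²-valued components. -/
theorem projection_fstCLM_sndCLM (u : H1per) :
    h1Graph.orthogonalProjectionOnto (inlCLM (fstCLM u)) +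
      h1Graph.orthogonalProjectionOnto (inrCLM (sndCLM u)) = u := by
  rw [← map_add]
  have : inlCLM (fstCLM u) + inrCLM (sndCLM u) = (u : WithLp 2 (L2 × L2)) := by
    refine WithLp.ofLp_injective 2 ?_
    refine Prod.ext ?_ ?_
    · change fstCLM u + 0 = fstCLM u
      rw [add_zero]
    · change 0 + sndCLM u = sndCLM u
      rw [zero_add]
  rw [this]
  exact Submodule.orthogonalProjectionOnto_mem_subspace_eq_self u

theorem uniformCn_transform {f : ℝ → ℝ} (hf : ContDiff ℝ ∞ f) (hs : HasCompactSupport f)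
    {ι : Type*} {k : ι → ℕ} (hk : ∀ i, 1 ≤ k i) (R : ℝ) (N : ℕ) :
    UniformCn N (fun _ : ι => Metric.ball (0 : H1per) R) fun i => transform f hf (k i) := by
  obtain ⟨F, hF0, hF⟩ := hs.exists_abs_le hf.continuous
  -- All exponents lie in [−2πF, 2πF], where exp may be replaced by a compactly supported function.
  obtain ⟨E, hE, hEs, hEexp⟩ := exists_hasCompactSupport_eq_exp (2 * π * F)
  have ho : ∀ _ : ι, IsOpen (Metric.ball (0 : H1per) R) := fun _ => Metric.isOpen_ball
  have hR : ∀ _ : ι, ∀ x ∈ Metric.ball (0 : H1per) R, ‖x‖ ≤ R := fun _ x hx =>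
    (mem_ball_zero_iff.1 hx).le
  have hP : UniformCn N (fun _ : ι => Metric.ball (0 : H1per) R) fun i u => projCLM (k i) u :=
    UniformCn.clm ho hR fun i => norm_projCLM_le (hk i)
  have hfP : UniformCn N (fun _ : ι => Metric.ball (0 : H1per) R)
      fun i u => superposition f hf.continuous (projCLM (k i) u) :=
    UniformCn.comp (F := CI) (G := CI) (uniformCn_superposition N hf hs) hP
      (fun _ => isOpen_univ) ho fun _ => mapsTo_univ _ _
  have hrate : UniformCn N (fun _ : ι => Metric.ball (0 : H1per) R)
      fun i u => rate hf.continuous (k i) u := hfP.clm_comp centerCLM ho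
  have hexpo : UniformCn N (fun _ : ι => Metric.ball (0 : H1per) R)
      fun i u => (-primitiveCLM) (rate hf.continuous (k i) u) := hrate.clm_comp (-primitiveCLM) ho
  have hA : UniformCn N (fun _ : ι => Metric.ball (0 : H1per) R)
      fun i u => expCI (-exponent hf.continuous (k i) u) := by
    have h1 := UniformCn.comp (F := CI) (G := CI) (uniformCn_superposition N hE hEs) hexpo
      (fun _ => isOpen_univ) ho fun _ => mapsTo_univ _ _
    refine h1.congr fun i u _ => ?_
    ext x
    refine (hEexp _ ?_).symm
    have h2 := (-exponent hf.continuous (k i) u).norm_coe_le_norm x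
    rw [norm_neg] at h2
    exact h2.trans (norm_exponent_le hf.continuous hF0 hF (k i) u)
  have hAs : UniformCn N (fun _ : ι => Metric.ball (0 : H1per) R)
      fun i u => -(expCI (-exponent hf.continuous (k i) u) * rate hf.continuous (k i) u) :=
    UniformCn.bilinear (F := CI) (G := CI) (H := CI) (-mulCLM (Icc (-π) π)) hA hrate ho
  have h0 : UniformCn N (fun _ : ι => Metric.ball (0 : H1per) R) fun _ u => fstCLM u :=
    UniformCn.clm ho hR fun _ => le_rfl
  have h1 : UniformCn N (fun _ : ι => Metric.ball (0 : H1per) R) fun _ u => sndCLM u :=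
    UniformCn.clm ho hR fun _ => le_rfl
  have e0 := UniformCn.clm_comp (h1Graph.orthogonalProjectionOnto.comp inlCLM)
    (UniformCn.bilinear mulL2 hA h0 ho) ho
  have e1 := UniformCn.clm_comp (h1Graph.orthogonalProjectionOnto.comp inrCLM)
    ((UniformCn.bilinear mulL2 hA h1 ho).add (UniformCn.bilinear mulL2 hAs h0 ho) ho) ho
  refine (e0.add e1 ho).congr fun i u _ => ?_
  simp only [ContinuousLinearMap.comp_apply]
  rw [← fstCLM_transform hf, ← sndCLM_transform hf, projection_fstCLM_sndCLM]

/-! ### The transform is uniformly expanding on balls for large `K` -/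

theorem exists_divided_difference_of_hasCompactSupport {h : ℝ → ℝ} (hh : ContDiff ℝ ∞ h)
    (hs : HasCompactSupport h) : ∃ (k : ℝ → ℝ → ℝ) (L : ℝ), Continuous (Function.uncurry k) ∧
      0 ≤ L ∧ (∀ a b, h a - h b = k a b * (a - b)) ∧ ∀ a b, |k a b| ≤ L := by
  obtain ⟨L, hL0, hL⟩ := hs.deriv.exists_abs_le (hh.continuous_deriv (by simp))
  obtain ⟨k, h1, h2, h3⟩ := (contDiff_infty.1 hh 1).exists_divided_difference hL
  exact ⟨k, L, h1, hL0, h2, h3⟩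

theorem exists_divided_difference_exp (B : ℝ) : ∃ (k : ℝ → ℝ → ℝ) (L : ℝ),
    Continuous (Function.uncurry k) ∧ 0 ≤ L ∧
      (∀ a b, |a| ≤ B → |b| ≤ B → exp a - exp b = k a b * (a - b)) ∧ ∀ a b, |k a b| ≤ L := by
  obtain ⟨E, hE, hEs, hEexp⟩ := exists_hasCompactSupport_eq_exp B
  obtain ⟨k, L, h1, h2, h3, h4⟩ := exists_divided_difference_of_hasCompactSupport hE hEs
  exact ⟨k, L, h1, h2, fun a b ha hb => by rw [← hEexp a ha, ← hEexp b hb, h3], h4⟩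

theorem hasDerivAt_integral_extend (v : CI) (x : ℝ) :
    HasDerivAt (fun x => ∫ y in (-π)..x, extend v y) (extend v x) x :=
  intervalIntegral.integral_hasDerivAt_right ((continuous_extend v).intervalIntegrable _ _)
    ((continuous_extend v).stronglyMeasurableAtFilter _ _) (continuous_extend v).continuousAt

/-- The exponents of two functions are controlled by their transforms and the Fourier tail. -/
theorem exists_norm_exponent_sub_le {f : ℝ → ℝ} (hf : ContDiff ℝ ∞ f) (hs : HasCompactSupport f)
    {B : ℝ} (hB : 0 ≤ B) : ∃ D, 0 ≤ D ∧ ∀ K : ℕ, 1 ≤ K → ∀ u u' : H1per,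
      ‖transform f hf K u'‖ ≤ B →
      ‖exponent hf.continuous K u - exponent hf.continuous K u'‖ ≤
          D * (‖transform f hf K u - transform f hf K u'‖ + (√K)⁻¹ * ‖u - u'‖) ∧
        ‖rate hf.continuous K u - rate hf.continuous K u'‖ ≤
          D * (‖transform f hf K u - transform f hf K u'‖ + (√K)⁻¹ * ‖u - u'‖) := by
  obtain ⟨F, hF0, hF⟩ := hs.exists_abs_le hf.continuous
  obtain ⟨kf, Lf, hkfc, hLf0, hkf, hkfb⟩ := exists_divided_difference_of_hasCompactSupport hf hs
  obtain ⟨ke, Le, hkec, hLe0, hke, hkeb⟩ := exists_divided_difference_exp (2 * π * F)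
  have hkfc' : ∀ {a b : ℝ → ℝ}, Continuous a → Continuous b → Continuous fun x => kf (a x) (b x) :=
    fun ha hb => hkfc.comp (ha.prodMk hb)
  have hkec' : ∀ {a b : ℝ → ℝ}, Continuous a → Continuous b → Continuous fun x => ke (a x) (b x) :=
    fun ha hb => hkec.comp (ha.prodMk hb)
  -- P bounds the coefficient p of the linear problem below, c·q bounds its source s, and A is the
  -- constant of the two-point estimate on an interval of length 2π.
  set P := 1 / 2 * Lf * (Le * (‖embed‖ * B)) with hP
  set c := 1 / 2 * Lf * (exp (2 * π * F) * ‖embed‖ + 1) with hc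
  set A := exp (P * (π - -π)) ^ 2 * (π - -π) * 2 with hA
  have hP0 : 0 ≤ P := by positivity
  have hc0 : 0 ≤ c := by positivity
  have hA0 : 0 ≤ A := by
    have : 0 ≤ π - -π := by linarith [pi_pos]
    positivity
  refine ⟨A * c + (P * (A * c) + 2 * c), by positivity, fun K hK u u' hw' => ?_⟩
  set w := transform f hf K u with hw
  set w' := transform f hf K u' with hw'd
  set q := ‖w - w'‖ + (√K)⁻¹ * ‖u - u'‖ with hq
  have hq0 : 0 ≤ q := by positivity
  set g := exponent hf.continuous K u with hg
  set g' := exponent hf.continuous K u' with hg'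
  set r := rate hf.continuous K u with hr
  set r' := rate hf.continuous K u' with hr'
  set v := projCLM K u with hv
  set v' := projCLM K u' with hv'
  set ρ := (embed - projCLM K) (u - u') with hρ
  set κ := 1 / 2 * ((2 * π)⁻¹ * integralCLM (superposition f hf.continuous v) -
    (2 * π)⁻¹ * integralCLM (superposition f hf.continuous v')) with hκ
  have hgb : ∀ x : Icc (-π) π, |g x| ≤ 2 * π * F := fun x =>
    (g.norm_coe_le_norm x).trans (norm_exponent_le hf.continuous hF0 hF K u)
  have hgb' : ∀ x : Icc (-π) π, |g' x| ≤ 2 * π * F := fun x =>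
    (g'.norm_coe_le_norm x).trans (norm_exponent_le hf.continuous hF0 hF K u')
  set p : ℝ → ℝ := fun x => 1 / 2 * kf (extend v x) (extend v' x) *
    (ke (extend g x) (extend g' x) * extend (embed w') x) with hp
  set s : ℝ → ℝ := fun x => 1 / 2 * kf (extend v x) (extend v' x) *
    (extend (expCI g) x * extend (embed (w - w')) x - extend ρ x) with hs'
  have hpc : Continuous p := (continuous_const.mul
    (hkfc' (continuous_extend v) (continuous_extend v'))).mul
    ((hkec' (continuous_extend g) (continuous_extend g')).mul (continuous_extend _))
  have hsc : Continuous s := (continuous_const.mul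
    (hkfc' (continuous_extend v) (continuous_extend v'))).mul
    (((continuous_extend _).mul (continuous_extend _)).sub (continuous_extend _))
  have hpb : ∀ x, |p x| ≤ P := fun x => by
    rw [hp, hP]
    simp only [abs_mul]
    rw [abs_of_pos (by norm_num : (0 : ℝ) < 1 / 2)]
    have h1 : |extend (embed w') x| ≤ ‖embed‖ * B := (abs_extend_le _ x).trans
      ((embed.le_opNorm w').trans (mul_le_mul_of_nonneg_left hw' (norm_nonneg embed)))
    gcongr
    · exact hkfb _ _
    · exact hkeb _ _
  have hsb : ∀ x, |s x| ≤ c * q := fun x => by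
    have h1 : |extend (expCI g) x| ≤ exp (2 * π * F) := (abs_extend_le _ x).trans
      (norm_expCI_le (norm_exponent_le hf.continuous hF0 hF K u))
    have h2 : |extend (embed (w - w')) x| ≤ ‖embed‖ * ‖w - w'‖ :=
      (abs_extend_le _ x).trans (embed.le_opNorm (w - w'))
    have h3 : |extend ρ x| ≤ (√K)⁻¹ * ‖u - u'‖ := (abs_extend_le _ x).trans
      (((embed - projCLM K).le_opNorm (u - u')).trans
        (mul_le_mul_of_nonneg_right (norm_embed_sub_projCLM_le hK) (norm_nonneg _)))
    have h4 : |extend (expCI g) x * extend (embed (w - w')) x - extend ρ x| ≤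
        (exp (2 * π * F) * ‖embed‖ + 1) * q := by
      refine (abs_sub _ _).trans ?_
      rw [abs_mul]
      have h5 : |extend (expCI g) x| * |extend (embed (w - w')) x| ≤
          exp (2 * π * F) * (‖embed‖ * ‖w - w'‖) := by gcongr
      have h6 : 0 ≤ (√K)⁻¹ * ‖u - u'‖ := by positivity
      have h7 : 0 ≤ exp (2 * π * F) * ‖embed‖ := by positivity
      have h8 : 0 ≤ ‖w - w'‖ := norm_nonneg _
      rw [hq]
      nlinarith [mul_nonneg h7 h6]
    rw [hs', hc]
    simp only [abs_mul]
    rw [abs_of_pos (by norm_num : (0 : ℝ) < 1 / 2), mul_assoc (1 / 2 * Lf)]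
    gcongr
    exact hkfb _ _
  -- P_K u = u − (1 − P_K)u = e^{g}w − (1 − P_K)u. Subtracting the same identity for u' isolates g −
  -- g', up to w − w' and the tail ρ.
  have hembed : ∀ x : Icc (-π) π, v x - v' x =
      ke (g x) (g' x) * embed w' x * (g x - g' x) + (exp (g x) * embed (w - w') x - ρ x) :=
    fun x => by
      have h1 : embed u x = exp (g x) * embed w x :=
        congrArg (fun φ : CI => φ x) (embed_eq_transform hf K u)
      have h2 : embed u' x = exp (g' x) * embed w' x :=
        congrArg (fun φ : CI => φ x) (embed_eq_transform hf K u')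
      have h3 : ρ x = (embed u x - embed u' x) - (v x - v' x) := by
        rw [hρ, _root_.sub_apply, map_sub, map_sub]
        rfl
      have h4 : embed (w - w') x = embed w x - embed w' x := by
        rw [map_sub]
        rfl
      have h5 := hke _ _ (hgb x) (hgb' x)
      rw [h3, h4, h1, h2]
      linear_combination embed w' x * h5
  have hrr : ∀ x : Icc (-π) π, r x - r' x = p x * (g x - g' x) + s x - κ := fun x => by
    have h1 : r x - r' x = 1 / 2 * (f (v x) - f (v' x)) - κ := by
      rw [hr, hr', rate, rate, centerCLM_apply, centerCLM_apply, hκ]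
      change 1 / 2 * (f (v x) - _) - 1 / 2 * (f (v' x) - _) = _
      ring
    rw [h1, hkf, hembed x]
    simp only [hp, hs', extend_coe]
    change _ = _ + 1 / 2 * kf (v x) (v' x) * (exp (g x) * _ - _) - κ
    ring
  -- G extends g − g' to the line. Its derivative is r − r' = pG + s − κ on the interval, and it
  -- vanishes at π because both rates have zero mean.
  set G : ℝ → ℝ := fun x => (∫ y in (-π)..x, extend r y) - ∫ y in (-π)..x, extend r' y with hG
  have hGx : ∀ x : Icc (-π) π, G x = g x - g' x := fun x => rfl
  have hGd : ∀ x ∈ Icc (-π) π, HasDerivAt G (p x * G x + s x - κ) x := fun x hx => by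
    refine ((hasDerivAt_integral_extend r x).sub (hasDerivAt_integral_extend r' x)).congr_deriv ?_
    rw [extend_of_mem r hx, extend_of_mem r' hx, hrr ⟨x, hx⟩, hGx ⟨x, hx⟩]
  have hGb : G π = 0 := by
    simp only [hG]
    rw [hr, hr', rate, rate, integral_extend_centerCLM, integral_extend_centerCLM, sub_zero]
  obtain ⟨hκb, hGbd⟩ := abs_le_of_two_point_problem neg_pi_lt_pi hpc hsc hGd (by simp [hG]) hGb
    (fun x _ => hpb x) (fun x _ => hsb x)
  have hgg : ∀ x : Icc (-π) π, |g x - g' x| ≤ A * c * q := fun x => by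
    rw [← hGx x]
    refine (hGbd x x.2).trans (le_of_eq ?_)
    rw [hA]
    ring
  have hAcq : 0 ≤ A * c * q := by positivity
  have hrest : 0 ≤ (P * (A * c) + 2 * c) * q := by positivity
  constructor
  · refine (ContinuousMap.norm_le _ (by positivity)).2 fun x => ?_
    rw [add_mul]
    exact (hgg x).trans (le_add_of_nonneg_right hrest)
  · refine (ContinuousMap.norm_le _ (by positivity)).2 fun x => ?_
    change |r x - r' x| ≤ _
    rw [hrr x, add_mul]
    have h1 : |p x * (g x - g' x)| ≤ P * (A * c * q) := by
      rw [abs_mul]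
      exact mul_le_mul (hpb x) (hgg x) (abs_nonneg _) hP0
    calc |p x * (g x - g' x) + s x - κ| ≤ |p x * (g x - g' x)| + |s x| + |κ| :=
          (abs_sub _ _).trans (add_le_add_left (abs_add_le _ _) _)
      _ ≤ P * (A * c * q) + c * q + c * q := add_le_add (add_le_add h1 (hsb x)) hκb
      _ = (P * (A * c) + 2 * c) * q := by ring
      _ ≤ _ := le_add_of_nonneg_left hAcq

/-- Differencing u = e^{g}w and its derivative leaves w − w' and the differences of exponents and
rates. These cost a multiple of ‖w − w'‖ + K^{-1/2}‖u − u'‖. -/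
theorem exists_norm_sub_le_transform {f : ℝ → ℝ} (hf : ContDiff ℝ ∞ f) (hs : HasCompactSupport f)
    (R : ℝ) : ∃ (K₀ : ℕ) (L : ℝ), ∀ K : ℕ, K₀ < K → ∀ u ∈ Metric.ball (0 : H1per) R,
      ∀ u' ∈ Metric.ball (0 : H1per) R,
      ‖u - u'‖ ≤ L * ‖transform f hf K u - transform f hf K u'‖ := by
  obtain ⟨F, hF0, hF⟩ := hs.exists_abs_le hf.continuous
  obtain ⟨ke, Le, hkec, hLe0, hke, hkeb⟩ := exists_divided_difference_exp (2 * π * F)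
  set b := exp (2 * π * F) with hb
  have hb0 : 0 < b := exp_pos _
  set B := b * (2 + F) * |R| with hB
  obtain ⟨D, hD0, hD⟩ := exists_norm_exponent_sub_le hf hs (B := B) (by positivity)
  set D₂ := (2 * (Le * D) + (b * D + Le * D * F)) * B with hD₂
  have hD₂0 : 0 ≤ D₂ := by positivity
  -- K > (2D₂)² makes D₂K^{-1/2} ≤ ½, so half of ‖u − u'‖ is absorbed on the left; this doubles the
  -- remaining constant.
  refine ⟨⌈(2 * D₂) ^ 2⌉₊, 2 * (b * (2 + F) + D₂), fun K hK u hu u' hu' => ?_⟩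
  have hK1 : 1 ≤ K := by omega
  have hKpos : (0 : ℝ) < √K := sqrt_pos.2 (by exact_mod_cast hK1)
  have hKs : D₂ * (√K)⁻¹ ≤ 1 / 2 := by
    have h1 : (2 * D₂) ^ 2 ≤ K := (Nat.le_ceil _).trans (by exact_mod_cast hK.le)
    have h2 : 2 * D₂ ≤ √K := le_sqrt_of_sq_le h1
    rw [← div_eq_mul_inv, div_le_iff₀ hKpos]
    linarith
  set w := transform f hf K u with hw
  set w' := transform f hf K u' with hw'
  have hwB : ‖w'‖ ≤ B := by
    refine (norm_transform_le hf hF0 hF K u').trans ?_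
    rw [mem_ball_zero_iff] at hu'
    exact mul_le_mul_of_nonneg_left (hu'.le.trans (le_abs_self R)) (by positivity)
  obtain ⟨hg, hr⟩ := hD K hK1 u u' hwB
  set q := ‖w - w'‖ + (√K)⁻¹ * ‖u - u'‖ with hq
  have hq0 : 0 ≤ q := by positivity
  set g := exponent hf.continuous K u with hgd
  set g' := exponent hf.continuous K u' with hgd'
  set r := rate hf.continuous K u with hrd
  set r' := rate hf.continuous K u' with hrd'
  have hgb : ‖g‖ ≤ 2 * π * F := norm_exponent_le hf.continuous hF0 hF K u
  have hgb' : ‖g'‖ ≤ 2 * π * F := norm_exponent_le hf.continuous hF0 hF K u'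
  have he : ‖expCI g‖ ≤ b := norm_expCI_le hgb
  have hrb : ‖r‖ ≤ F := norm_rate_le hf.continuous hF0 hF K u
  have hrb' : ‖r'‖ ≤ F := norm_rate_le hf.continuous hF0 hF K u'
  have hee : ‖expCI g - expCI g'‖ ≤ Le * D * q := by
    refine (ContinuousMap.norm_le _ (by positivity)).2 fun x => ?_
    change |exp (g x) - exp (g' x)| ≤ _
    rw [hke _ _ ((g.norm_coe_le_norm x).trans hgb) ((g'.norm_coe_le_norm x).trans hgb'), abs_mul,
      mul_assoc]
    exact mul_le_mul (hkeb _ _) (((g - g').norm_coe_le_norm x).trans hg) (abs_nonneg _) hLe0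
  have her : ‖expCI g * r‖ ≤ b * F :=
    (norm_mul_le _ _).trans (mul_le_mul he hrb (norm_nonneg _) hb0.le)
  have heer : ‖expCI g * r - expCI g' * r'‖ ≤ b * (D * q) + Le * D * q * F := by
    have h1 : expCI g * r - expCI g' * r' = expCI g * (r - r') + (expCI g - expCI g') * r' := by
      ring
    rw [h1]
    refine (norm_add_le _ _).trans (add_le_add ?_ ?_)
    · exact (norm_mul_le _ _).trans (mul_le_mul he hr (norm_nonneg _) hb0.le)
    · exact (norm_mul_le _ _).trans (mul_le_mul hee hrb' (norm_nonneg _) (by positivity))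
  have hfst : fstCLM (u - u') = mulL2 (expCI g) (fstCLM (w - w')) +
      mulL2 (expCI g - expCI g') (fstCLM w') := by
    rw [map_sub, map_sub, map_sub, map_sub, _root_.sub_apply, fstCLM_eq_transform hf K u,
      fstCLM_eq_transform hf K u']
    abel
  have hsnd : sndCLM (u - u') = (mulL2 (expCI g) (sndCLM (w - w')) +
      mulL2 (expCI g - expCI g') (sndCLM w')) + (mulL2 (expCI g * r) (fstCLM (w - w')) +
      mulL2 (expCI g * r - expCI g' * r') (fstCLM w')) := by
    simp only [map_sub, _root_.sub_apply]
    rw [sndCLM_eq_transform hf K u, sndCLM_eq_transform hf K u']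
    abel
  have hM : ∀ (a : CI) (y : L2) (α β : ℝ), ‖a‖ ≤ α → ‖y‖ ≤ β → ‖mulL2 a y‖ ≤ α * β :=
    fun a y α β h1 h2 => (norm_mulL2_le a y).trans
      (mul_le_mul h1 h2 (norm_nonneg _) ((norm_nonneg _).trans h1))
  have n0 : ‖fstCLM (u - u')‖ ≤ b * ‖w - w'‖ + Le * D * q * B := by
    rw [hfst]
    exact (norm_add_le _ _).trans (add_le_add (hM _ _ _ _ he (norm_fstCLM_le _))
      (hM _ _ _ _ hee ((norm_fstCLM_le _).trans hwB)))
  have n1 : ‖sndCLM (u - u')‖ ≤ (b * ‖w - w'‖ + Le * D * q * B) +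
      (b * F * ‖w - w'‖ + (b * (D * q) + Le * D * q * F) * B) := by
    rw [hsnd]
    exact (norm_add_le _ _).trans (add_le_add
      ((norm_add_le _ _).trans (add_le_add (hM _ _ _ _ he (norm_sndCLM_le _))
        (hM _ _ _ _ hee ((norm_sndCLM_le _).trans hwB))))
      ((norm_add_le _ _).trans (add_le_add (hM _ _ _ _ her (norm_fstCLM_le _))
        (hM _ _ _ _ heer ((norm_fstCLM_le _).trans hwB)))))
  have htot : ‖u - u'‖ ≤ b * (2 + F) * ‖w - w'‖ + D₂ * q := by
    refine (norm_le_fstCLM_add_sndCLM (u - u')).trans ((add_le_add n0 n1).trans (le_of_eq ?_))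
    rw [hD₂]
    ring
  have h5 : D₂ * q ≤ D₂ * ‖w - w'‖ + 1 / 2 * ‖u - u'‖ := by
    rw [hq, mul_add, ← mul_assoc]
    gcongr
  linarith

/-! ### Surjectivity of the derivative -/

theorem mulSmooth_congr {g g' : ℝ → ℝ} (h : g = g') (hg : ContDiff ℝ ∞ g)
    (hper : Function.Periodic g (2 * π)) (hg' : ContDiff ℝ ∞ g')
    (hper' : Function.Periodic g' (2 * π)) : mulSmooth g hg hper = mulSmooth g' hg' hper' := by
  subst h
  rfl

/-- The first Fourier coefficients. -/
noncomputable def coeffLM (K : ℕ) : H1per →ₗ[ℝ] Fin (K + 1) → ℝ × ℝ :=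
  LinearMap.pi fun n => (cosCLM n).toLinearMap.prod (sinCLM n).toLinearMap

theorem fourierProj_add_smul_of_coeffLM_eq_zero {K : ℕ} {h : H1per} (hh : coeffLM K h = 0)
    (u : H1per) (t : ℝ) : fourierProj K (u + t • h) = fourierProj K u := by
  have h1 : ∀ n ≤ K, cosCLM n h = 0 ∧ sinCLM n h = 0 := fun n hn =>
    Prod.mk_eq_zero.1 (congrFun hh ⟨n, Nat.lt_succ_of_le hn⟩)
  have h2 : ∀ n ≤ K, cosCoeff (u + t • h).toFun n = cosCoeff u.toFun n := fun n hn => by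
    rw [← cosCLM_apply, ← cosCLM_apply, map_add, map_smul, (h1 n hn).1, smul_zero, add_zero]
  have h3 : ∀ n ≤ K, sinCoeff (u + t • h).toFun n = sinCoeff u.toFun n := fun n hn => by
    rw [← sinCLM_apply, ← sinCLM_apply, map_add, map_smul, (h1 n hn).2, smul_zero, add_zero]
  ext x
  rw [fourierProj, fourierProj, h2 0 (Nat.zero_le _)]
  congr 1
  refine Finset.sum_congr rfl fun n hn => ?_
  rw [h2 n (Finset.mem_Icc.1 hn).2, h3 n (Finset.mem_Icc.1 hn).2]

/-- Along h without Fourier modes up to K the factor is frozen and W is affine, so its derivative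
there is multiplication by a(u)⁻¹, a bijection of H¹. Such h form a subspace of finite codimension.
-/
theorem surjective_fderiv_transform {f : ℝ → ℝ} (hf : ContDiff ℝ ∞ f) (K : ℕ) (u : H1per)
    (hd : DifferentiableAt ℝ (transform f hf K) u)
    (hinj : Function.Injective (fderiv ℝ (transform f hf K) u)) :
    Function.Surjective (fderiv ℝ (transform f hf K) u) := by
  have h0 : ∀ x, (factor f hf K u x)⁻¹ ≠ 0 := fun x => by
    rw [factor_eq_exp]
    exact inv_ne_zero (exp_pos _).ne'
  refine LinearMap.surjective_of_injective_of_eqOn_ker (coeffLM K)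
    (S := mulSmoothLM (contDiff_factor_inv hf K u) (periodic_factor_inv hf K u))
    (T := (fderiv ℝ (transform f hf K) u).toLinearMap)
    (bijective_mulSmoothLM _ _ h0) hinj fun h hh => ?_
  set S := mulSmoothLM (contDiff_factor_inv hf K u) (periodic_factor_inv hf K u)
  have h1 : (fun t : ℝ => transform f hf K (u + t • h)) = fun t => S u + t • S h := by
    ext1 t
    have h2 : factor f hf K (u + t • h) = factor f hf K u := by
      rw [factor_eq_exp, factor_eq_exp]
      ext x
      rw [factorExponent, factorExponent, fourierProj_add_smul_of_coeffLM_eq_zero hh u t]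
    rw [← map_smul, ← map_add]
    exact congrFun (mulSmooth_congr (by rw [h2]) _ _ (contDiff_factor_inv hf K u)
      (periodic_factor_inv hf K u)) _
  refine (hd.hasFDerivAt.hasLineDerivAt h).unique ?_
  rw [HasLineDerivAt, h1]
  simpa using ((hasDerivAt_id (0 : ℝ)).smul_const (S h)).const_add (S u)

end PeriodicRDA

/-! ### Assembly of the main theorem -/

theorem mainTheorem4 (f : ℝ → ℝ) (hf : ContDiff ℝ ∞ f) (hsupp : HasCompactSupport f) :
    ∃ C : ℝ, 1 < C ∧ ∀ R : ℝ, 0 < R →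
      ∃ (K₀ : ℕ) (M : ℕ → ℝ), ∀ K : ℕ, K₀ < K →
        ∃ U : PeriodicRDA.H1per → PeriodicRDA.H1per,
          PeriodicRDA.IsSmoothDiffeoOn (PeriodicRDA.transform f hf K) U (Metric.ball 0 R) ∧
          (∀ n : ℕ, ∀ u ∈ Metric.ball (0 : PeriodicRDA.H1per) R,
            ‖iteratedFDeriv ℝ n (PeriodicRDA.transform f hf K) u‖ ≤ M n) ∧
          (∀ n : ℕ, ∀ w ∈ PeriodicRDA.transform f hf K '' Metric.ball 0 R,
            ‖iteratedFDeriv ℝ n U w‖ ≤ M n) ∧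
          Metric.ball 0 (C⁻¹ * R) ⊆ PeriodicRDA.transform f hf K '' Metric.ball 0 R ∧
          PeriodicRDA.transform f hf K '' Metric.ball 0 R ⊆ Metric.ball 0 (C * R) := by
  obtain ⟨F, hF0, hF⟩ := hsupp.exists_abs_le hf.continuous
  have hC : 1 < exp (2 * π * F) * (2 + F) := by
    have h1 : 1 ≤ exp (2 * π * F) := one_le_exp (by positivity)
    nlinarith
  refine ⟨exp (2 * π * F) * (2 + F), hC, fun R hR => ?_⟩
  obtain ⟨K₀, L, hL⟩ := PeriodicRDA.exists_norm_sub_le_transform hf hsupp R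
  -- Taking all K > K₀ as the index set makes uniformity in the index the required independence of
  -- K.
  let k : {K : ℕ // K₀ < K} → ℕ := Subtype.val
  have hk : ∀ i, 1 ≤ k i := fun i => Nat.one_le_iff_ne_zero.2 (Nat.ne_zero_of_lt i.2)
  have hW := PeriodicRDA.uniformCn_transform hf hsupp hk R
  have hdiff : ∀ i, ∀ u ∈ Metric.ball (0 : PeriodicRDA.H1per) R,
      HasFDerivAt (PeriodicRDA.transform f hf (k i))
        (fderiv ℝ (PeriodicRDA.transform f hf (k i)) u) u :=
    fun i u hu => (hW 1).hasFDerivAt (fun _ => Metric.isOpen_ball) i hu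
  have hsurj : ∀ i, ∀ u ∈ Metric.ball (0 : PeriodicRDA.H1per) R,
      Function.Surjective (fderiv ℝ (PeriodicRDA.transform f hf (k i)) u) := fun i u hu => by
    refine PeriodicRDA.surjective_fderiv_transform hf (k i) u (hdiff i u hu).differentiableAt ?_
    rw [injective_iff_map_eq_zero]
    intro h hh
    have := (hdiff i u hu).norm_le_of_norm_sub_le (Metric.isOpen_ball.mem_nhds hu)
      (fun v hv => hL (k i) i.2 v hv u hu) h
    rw [hh, norm_zero, mul_zero] at this
    exact norm_le_zero_iff.1 this
  obtain ⟨U, hopen, hleft, hU⟩ := UniformCn.exists_inverse hW Metric.isOpen_ball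
    Metric.isBounded_ball (fun i => hL (k i) i.2) hsurj
  choose M₁ hM₁ using fun n => (hW n).bound n le_rfl
  choose M₂ hM₂ using fun n => (hU n).bound n le_rfl
  refine ⟨K₀, fun n => max (M₁ n) (M₂ n), fun K hK => ?_⟩
  refine ⟨U ⟨K, hK⟩, ⟨Metric.isOpen_ball, hopen ⟨K, hK⟩, hleft ⟨K, hK⟩,
    contDiffOn_infty.2 fun n => (hW n).contDiffOn ⟨K, hK⟩,
    contDiffOn_infty.2 fun n => (hU n).contDiffOn ⟨K, hK⟩⟩, fun n u hu => ?_, fun n w hw => ?_,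
    ?_, ?_⟩
  · rw [← iteratedFDerivWithin_of_isOpen n Metric.isOpen_ball hu]
    exact (hM₁ n ⟨K, hK⟩ u hu).trans (le_max_left _ _)
  · rw [← iteratedFDerivWithin_of_isOpen n (hopen ⟨K, hK⟩) hw]
    exact (hM₂ n ⟨K, hK⟩ w hw).trans (le_max_right _ _)
  · exact ball_subset_image_ball hR (by linarith) ((hW 0).contDiffOn ⟨K, hK⟩).continuousOn
      (hopen ⟨K, hK⟩) (hL K hK) (PeriodicRDA.transform_zero hf K)
      (PeriodicRDA.norm_le_transform hf hF0 hF K)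
  · rintro _ ⟨u, hu, rfl⟩
    rw [mem_ball_zero_iff] at hu ⊢
    exact (PeriodicRDA.norm_transform_le hf hF0 hF K u).trans_lt
      (mul_lt_mul_of_pos_left hu (by linarith))
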